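/- \textbf{Conventions.} Graphs are finite, undirected, loopless, and may have parallel edges. A \emph{cut} of $G$ is a set $F\subseteq E(G)$ such that $G-F$ has more connected components than $G$; $G$ is \emph{$3$-edge-connected} if every cut has at least three edges. For $X,Y\subseteq V(G)$, $E_G(X,Y)$ is the set of edges with one end in $X$ and the other in $Y$. A \emph{path} has distinct edges and distinct vertices, except that its two end vertices are allowed to coincide (so two parallel edges $e,f$ form a path that starts with $e$ and ends with $f$). A path \emph{links} $A\subseteq E(G)$ and $B\subseteq E(G)$ if its first edge is in $A$, its last edge is in $B$, and no internal edge is in $A\cup B$ (a single edge of $A\cap B$ is such a path). A set $F\subseteq E(G)$ is an \emph{$(A,B)$-cut} if no path of $G-F$ links $A$ and $B$. A \emph{tree-cut decomposition} $(T,\mathcal X)$ of $G$ consists of a finite tree $T$ and pairwise disjoint, possibly empty, sets $X_t$ ($t\in V(T)$) with union $V(G)$. Edges of $T$ are called \emph{links}. The \emph{adhesion} $\mathrm{adh}(l)$ of a link $l$ is the set of edges of $G$ whose ends lie in bags of different components of $T-l$. The \emph{width} is the maximum of all numbers $|\mathrm{adh}(l)|$ (over links $l$) and $|X_t|+|\{t'\in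 N_T(t): |\mathrm{adh}(tt')|>2\}|$ (over nodes $t$); $\mathrm{tcw}(G)$ is the minimum width of a tree-cut decomposition of $G$. For links $a,b$, $aTb$ is the path of $T$ that starts with $a$ and ends with $b$. The decomposition is \emph{lean} if for all $k\in\mathbb N$, all links $a,b$ and all $A\subseteq \mathrm{adh}(a)$, $B\subseteq\mathrm{adh}(b)$ with $|A|=|B|=k$, there are $k$ pairwise edge-disjoint paths linking $A$ and $B$, or some link $c$ of $aTb$ has $|\mathrm{adh}(c)|<k$. A \emph{non-leanness certificate} is a quintuple $(k,a,b,A,B)$, $k\ge1$, with $a,b,A,B$ as above for which both alternatives fail; it is \emph{minimal} if, among all certificates of $(T,\mathcal X)$, $k$ is minimum and, subject to that, $aTb$ has the fewest links. With $m=|E(G)|$, the \emph{fatness} of $(T,\mathcal X)$ is $(\alpha_m,-\beta_m,\dots,\alpha_1,-\beta_1)$, where $\alpha_i$ and $\beta_i$ are the numbers of edges and of connected components of the subgraph of $T$ induced by the links with adhesion of size at least $i$ (its nodes are the ends of these links). Fatnesses are ordered lexicographically. For links $a,b$ and a partition $(V_1,V_2)$ of $V(G)$, the \emph{$(a,b,V_1,V_2)$-segregation}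 has as tree the disjoint union of a copy $U_1$ of $T$ in which $b$ is subdivided by a new node $s_1$ and a copy $U_2$ of $T$ in which $a$ is subdivided by a new node $s_2$, plus the link $s_1s_2$; the bag of the copy of $t\in V(T)$ in $U_i$ is $X_t\cap V_i$, and the bags of $s_1,s_2$ are empty. \textbf{Statement.} Let $G$ be a $3$-edge-connected graph. (1) Let $(T,\mathcal X)$ be a tree-cut decomposition of $G$ of width $w$ that is not lean. Then $G$ has a tree-cut decomposition of width at most $w$ whose fatness is strictly smaller than that of $(T,\mathcal X)$. Moreover, $(T,\mathcal X)$ has a minimal non-leanness certificate, and for every minimal non-leanness certificate $(k,a,b,A,B)$ there are an $(A,B)$-cut $F$ of minimum size and a partition $(V_1,V_2)$ of $V(G)$ such that $F=E_G(V_1,V_2)$, $A\subseteq E(G[V_1])\cup F$, $B\subseteq E(G[V_2])\cup F$, and the $(a,b,V_1,V_2)$-segregation of $(T,\mathcal X)$ is a tree-cut decomposition of $G$ of width at most $w$ and of fatness strictly smaller than that of $(T,\mathcal X)$. (2) There is no infinite sequence of tree-cut decompositions of $G$ with strictly decreasing fatness. (3) $G$ has a lean tree-cut decomposition of width $\mathrm{tcw}(G)$.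 -/

import Mathlib

open scoped Graph

namespace TreeCut

universe u v

variable {α : Type u} {β : Type v}

/-! ### Multigraphs: cuts, paths between edge sets -/

/-- The number of connected components of a multigraph. -/
noncomputable def numComponents (G : Graph α β) : ℕ :=
  Nat.card G.toSimpleGraph.ConnectedComponent

/-- A cut is a set of edges whose deletion increases the number of connected components. -/
def IsCut (G : Graph α β) (F : Set β) : Prop :=
  F ⊆ E(G) ∧ numComponents G < numComponents (G.deleteEdges F)

/-- `G` is `k`-edge-connected if it has no cut on strictly less than `k` edges. -/
def EdgeConnected (G : Graph α β) (k : ℕ) : Prop :=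
  ∀ F : Set β, IsCut G F → k ≤ F.ncard

/-- The set of edges of `G` with one endpoint in `X` and the other one in `Y`. -/
def edgesBetween (G : Graph α β) (X Y : Set α) : Set β :=
  {e | ∃ x ∈ X, ∃ y ∈ Y, G.IsLink e x y}

/-- A path `vertex 0, edge 0, vertex 1, …, edge (length - 1), vertex length`: the edges are
distinct and the vertices are distinct, except that the two end vertices may coincide. This
exception makes two parallel edges `e`, `f` a path that starts with `e` and ends with `f`. -/
structure EdgePath (G : Graph α β) where
  length : ℕ
  vertex : Fin (length + 1) → α
  edge : Fin length → β
  isLink : ∀ i : Fin length, G.IsLink (edge i) (vertex i.castSucc) (vertex i.succ)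
  edge_injective : Function.Injective edge
  vertex_distinct : ∀ i j : Fin (length + 1), i < j → vertex i = vertex j →
    i = 0 ∧ j = Fin.last length

/-- A path links the edge sets `A` and `B` if its first edge is in `A`, its last edge is in `B`,
and none of its internal edges is in `A ∪ B`. -/
def EdgePath.Links {G : Graph α β} (P : EdgePath G) (A B : Set β) : Prop :=
  ∃ h : 0 < P.length,
    P.edge ⟨0, h⟩ ∈ A ∧
    P.edge ⟨P.length - 1, Nat.sub_lt h Nat.one_pos⟩ ∈ B ∧
    ∀ i : Fin P.length, 0 < i.val → i.val < P.length - 1 → P.edge i ∉ A ∪ B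

/-- There are `k` pairwise edge-disjoint paths of `G` linking `A` to `B`. -/
def HasDisjointPaths (G : Graph α β) (k : ℕ) (A B : Set β) : Prop :=
  ∃ P : Fin k → EdgePath G,
    (∀ i, (P i).Links A B) ∧
    ∀ i j, i ≠ j → Disjoint (Set.range (P i).edge) (Set.range (P j).edge)

/-- `F` is an `(A, B)`-cut of `G`: no path links `A` and `B` in `G - F`. -/
def IsSeparator (G : Graph α β) (A B F : Set β) : Prop :=
  F ⊆ E(G) ∧ ¬ ∃ P : EdgePath (G.deleteEdges F), P.Links A B

/-- `F` is an `(A, B)`-cut of `G` of minimum size. -/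
def IsMinSeparator (G : Graph α β) (A B F : Set β) : Prop :=
  IsSeparator G A B F ∧ ∀ F' : Set β, IsSeparator G A B F' → F.ncard ≤ F'.ncard

/-! ### Trees -/

/-- The set of links of the path `aTb` that starts with the link `a` and ends with the link `b`
(in a tree this path is unique up to its direction; it is reduced to `a` if `a = b`). -/
def linkPath {N : Type*} (T : SimpleGraph N) (a b : Sym2 N) : Set (Sym2 N) :=
  {c | ∃ (s t : N) (p : T.Walk s t), p.IsPath ∧
    p.edges.head? = some a ∧ p.edges.getLast? = some b ∧ c ∈ p.edges}

/-- The graph obtained from `T` by subdividing the link `l` once; the subdivision node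
is `none`. -/
def subdivide {N : Type*} (T : SimpleGraph N) (l : Sym2 N) : SimpleGraph (Option N) :=
  SimpleGraph.fromRel fun x y =>
    match x, y with
    | some s, some t => T.Adj s t ∧ s(s, t) ≠ l
    | none, some t => t ∈ l
    | _, none => False

/-! ### Tree-cut decompositions -/

/-- A tree-cut decomposition of `G`: a finite tree and a family of pairwise disjoint, possibly
empty, bags indexed by its nodes, whose union is the vertex set of `G`. -/
structure TreeCutDecomposition (G : Graph α β) where
  Node : Type
  finite_node : Finite Node
  tree : SimpleGraph Node
  isTree : tree.IsTree
  bag : Node → Set α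
  disjoint_bag : ∀ s t, s ≠ t → Disjoint (bag s) (bag t)
  iUnion_bag : ⋃ t, bag t = V(G)

namespace TreeCutDecomposition

variable {G : Graph α β}

/-- The adhesion of a link `l`: the edges of `G` whose two endpoints lie in bags of nodes in
different components of `T - l`. -/
def adhesion (D : TreeCutDecomposition G) (l : Sym2 D.Node) : Set β :=
  {e | ∃ s t : D.Node, ¬ (D.tree.deleteEdges {l}).Reachable s t ∧
    e ∈ edgesBetween G (D.bag s) (D.bag t)}

/-- The width: the maximum of the sizes of the adhesions of all links, and of the numbers
`|X_t| + |{t' ∈ N_T(t) : the adhesion of tt' has size more than two}|` for all nodes `t`. -/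
noncomputable def width (D : TreeCutDecomposition G) : ℕ :=
  max (⨆ l : D.tree.edgeSet, (D.adhesion l).ncard)
    (⨆ t : D.Node, ((D.bag t).ncard +
      {t' : D.Node | D.tree.Adj t t' ∧ 2 < (D.adhesion s(t, t')).ncard}.ncard))

/-- Leanness: edge sets of size `k` in the adhesions of two links `a`, `b` are linked by `k`
edge-disjoint paths unless a link of `aTb` has an adhesion of size less than `k`. -/
def IsLeanDecomposition (D : TreeCutDecomposition G) : Prop :=
  ∀ (k : ℕ) (a b : Sym2 D.Node), a ∈ D.tree.edgeSet → b ∈ D.tree.edgeSet →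
    ∀ A B : Set β, A ⊆ D.adhesion a → B ⊆ D.adhesion b → A.ncard = k → B.ncard = k →
      HasDisjointPaths G k A B ∨ ∃ c ∈ linkPath D.tree a b, (D.adhesion c).ncard < k

/-- Non-leanness certificates `(k, a, b, A, B)`. -/
structure IsCertificate (D : TreeCutDecomposition G) (k : ℕ) (a b : Sym2 D.Node)
    (A B : Set β) : Prop where
  one_le : 1 ≤ k
  left_mem : a ∈ D.tree.edgeSet
  right_mem : b ∈ D.tree.edgeSet
  left_subset : A ⊆ D.adhesion a
  right_subset : B ⊆ D.adhesion b
  left_card : A.ncard = k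
  right_card : B.ncard = k
  not_linked : ¬ HasDisjointPaths G k A B
  le_adhesion : ∀ c ∈ linkPath D.tree a b, k ≤ (D.adhesion c).ncard

/-- Minimal non-leanness certificates: `k` is minimum and, subject to that, the distance between
the links `a` and `b`, measured by the number of links of `aTb`, is minimum. -/
def IsMinimalCertificate (D : TreeCutDecomposition G) (k : ℕ) (a b : Sym2 D.Node)
    (A B : Set β) : Prop :=
  D.IsCertificate k a b A B ∧
    ∀ (k' : ℕ) (a' b' : Sym2 D.Node) (A' B' : Set β), D.IsCertificate k' a' b' A' B' →
      k < k' ∨ k = k' ∧ (linkPath D.tree a b).ncard ≤ (linkPath D.tree a' b').ncard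

/-- The tree of the `(a, b, V₁, V₂)`-segregation: the disjoint union of a copy of `T` in which `b`
is subdivided and a copy of `T` in which `a` is subdivided, plus a link that joins the two
subdivision nodes. -/
def segregationTree (D : TreeCutDecomposition G) (a b : Sym2 D.Node) :
    SimpleGraph (Option D.Node ⊕ Option D.Node) :=
  (subdivide D.tree b).sum (subdivide D.tree a) ⊔
    SimpleGraph.edge (Sum.inl none) (Sum.inr none)

/-- The bags of the `(a, b, V₁, V₂)`-segregation. -/
def segregationBag (D : TreeCutDecomposition G) (V₁ V₂ : Set α) :
    Option D.Node ⊕ Option D.Node → Set α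
  | Sum.inl (some t) => D.bag t ∩ V₁
  | Sum.inr (some t) => D.bag t ∩ V₂
  | Sum.inl none => ∅
  | Sum.inr none => ∅

/-- `D'` is (up to renaming the nodes) the `(a, b, V₁, V₂)`-segregation of `D`. -/
def IsSegregation (D : TreeCutDecomposition G) (a b : Sym2 D.Node) (V₁ V₂ : Set α)
    (D' : TreeCutDecomposition G) : Prop :=
  ∃ φ : D'.tree ≃g D.segregationTree a b, ∀ t, D'.bag t = D.segregationBag V₁ V₂ (φ t)

/-- The links with an adhesion of size at least `i`, as a graph on all nodes. -/
def linkGraph (D : TreeCutDecomposition G) (i : ℕ) : SimpleGraph D.Node :=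
  SimpleGraph.fromEdgeSet {l | l ∈ D.tree.edgeSet ∧ i ≤ (D.adhesion l).ncard}

/-- `α_i`: the number of links with an adhesion of size at least `i`. -/
noncomputable def alpha (D : TreeCutDecomposition G) (i : ℕ) : ℕ :=
  (D.linkGraph i).edgeSet.ncard

/-- `β_i`: the number of connected components of the subgraph of `T` induced by the links with an
adhesion of size at least `i` (the nodes of this subgraph are the ends of these links). -/
noncomputable def beta (D : TreeCutDecomposition G) (i : ℕ) : ℕ :=
  Nat.card ((D.linkGraph i).induce (D.linkGraph i).support).ConnectedComponent

/-- The fatness `(α_m, -β_m, α_{m-1}, -β_{m-1}, …, α_1, -β_1)`, where `m` is the number of edges of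
`G`; such tuples are compared lexicographically. -/
noncomputable def fatness (D : TreeCutDecomposition G) : Lex (Fin (2 * E(G).ncard) → ℤ) :=
  toLex fun j =>
    if j.val % 2 = 0 then (D.alpha (E(G).ncard - j.val / 2) : ℤ)
    else -(D.beta (E(G).ncard - j.val / 2) : ℤ)

end TreeCutDecomposition

/-- The tree-cut width of `G`: the minimum width of a tree-cut decomposition of `G`. -/
noncomputable def treeCutWidth (G : Graph α β) : ℕ :=
  sInf {w | ∃ D : TreeCutDecomposition G, D.width = w}

end TreeCut

/-! Adhesions are edge boundaries: if `S` is one side of a link, its adhesion is the set of edges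
leaving the union of the bags in `S`. Everything is therefore an uncrossing argument about
boundaries in `G`.

Take a minimal certificate `(k, a, b, A, B)`. Menger's theorem, applied to the line graph, gives an
`(A, B)`-cut of size less than `k`; let `μ` be the minimum size. Minimality of `k` makes a minimum
cut equal to the whole boundary of a vertex set `W` (`IsMinimalCertificate.boundary_eq`), with every
edge of `A` meeting `W` and every edge of `B` meeting its complement. In the segregation, a link
with side `C` gets copies with adhesions `∂(C ∩ W)` and `∂(C \ W)`, with `C` chosen away from `b`,
respectively from `a`. Since no `(A, B)`-cut has fewer than `μ` edges, submodularity shows that no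
copy exceeds its original (`IsConfig.inter_le`), and that the halves of the subdivided links are
strictly smaller (`IsConfig.inter_lt`). This gives the width bound.

For the fatness, two copies of one link must not both have size at least `k` when one of them has
full size. If the link separates `a` from `b`, submodularity gives this. Otherwise `W` is chosen so
that each such side is either not crossed at all or is cut into two strictly smaller pieces
(`IsConfig.exists_uncrossed`). Consider the highest level, at least `k`, at which some link lacks a
full-size copy. If there is one, `α` drops there. If there is none, the full copies of `a` and `b`
lie in different trees, joined only by a link of adhesion at most `μ < k`, so `β_k` grows
(`IsReduction.beta_lt`). Higher levels never get worse, and the fatness decreases.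

Fatness is well-founded because `β ≤ α`: on ties of `α`, the entry `-β` can be replaced by the
natural number `α - β`. A decomposition of minimum width with minimal fatness is then lean. -/

namespace TreeCut

universe u v

variable {α : Type u} {β : Type v}

/-! ### Menger's theorem for directed graphs -/

/-- In the directed graph with arc set `R`, there is a directed walk from `a` to `b` all of whose
vertices belong to `S`. -/
def ArcReach (R : Set (β × β)) (S : Set β) (a b : β) : Prop :=
  a ∈ S ∧ Relation.ReflTransGen (fun u w => (u, w) ∈ R ∧ u ∈ S ∧ w ∈ S) a b

/-- Every directed walk from `A` to `B` meets `X`. -/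
def ArcSep (R : Set (β × β)) (A B X : Set β) : Prop :=
  ∀ a ∈ A, ∀ b ∈ B, ¬ ArcReach R Xᶜ a b

namespace ArcReach

variable {R R' : Set (β × β)} {S S' P : Set β} {a b c x y : β}

lemma refl (h : a ∈ S) : ArcReach R S a a := ⟨h, .refl⟩

lemma left_mem (h : ArcReach R S a b) : a ∈ S := h.1

lemma right_mem (h : ArcReach R S a b) : b ∈ S := by
  obtain ⟨ha, h⟩ := h
  cases h with
  | refl => exact ha
  | tail _ h => exact h.2.2

lemma tail (h : ArcReach R S a b) (hbc : (b, c) ∈ R) (hc : c ∈ S) : ArcReach R S a c :=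
  ⟨h.1, h.2.tail ⟨hbc, h.right_mem, hc⟩⟩

lemma head (h : ArcReach R S b c) (hab : (a, b) ∈ R) (ha : a ∈ S) : ArcReach R S a c :=
  ⟨ha, h.2.head ⟨hab, ha, h.1⟩⟩

lemma trans (h : ArcReach R S a b) (h' : ArcReach R S b c) : ArcReach R S a c :=
  ⟨h.1, h.2.trans h'.2⟩

lemma mono (h : ArcReach R S a b) (hR : R ⊆ R') (hS : S ⊆ S') : ArcReach R' S' a b :=
  ⟨hS h.1, Relation.ReflTransGen.mono (fun _ _ ⟨h₁, h₂, h₃⟩ => ⟨hR h₁, hS h₂, hS h₃⟩) _ _ h.2⟩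

lemma swap (h : ArcReach R S a b) : ArcReach (Prod.swap ⁻¹' R) S b a := by
  refine ⟨h.right_mem, ?_⟩
  have := Relation.reflTransGen_swap.2 h.2
  exact Relation.ReflTransGen.mono (fun _ _ ⟨h₁, h₂, h₃⟩ => ⟨h₁, h₃, h₂⟩) _ _ this

lemma of_insert (h : ArcReach (insert (x, y) R) S a b) (hxy : x ∉ S ∨ y ∉ S) :
    ArcReach R S a b := by
  refine ⟨h.1, Relation.ReflTransGen.mono (fun u w ⟨h₁, h₂, h₃⟩ => ⟨?_, h₂, h₃⟩) _ _ h.2⟩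
  rcases h₁ with h₁ | h₁
  · obtain ⟨rfl, rfl⟩ := Prod.mk.inj h₁
    tauto
  · exact h₁

/-- Since `P` contains the tail `x` of the extra arc, a walk cannot use that arc before it has
visited `P`. In the arc-deletion induction this transfers separators between the two arc sets. -/
lemma avoid_or_hit (h : ArcReach (insert (x, y) R) S a b) (hx : x ∈ P) :
    ArcReach (insert (x, y) R) (S ∩ Pᶜ) a b ∨ ∃ p ∈ P, ArcReach R S a p := by
  obtain ⟨ha, h⟩ := h
  induction h with
  | refl =>
    by_cases haP : a ∈ P
    · exact .inr ⟨a, haP, refl ha⟩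
    · exact .inl (refl ⟨ha, haP⟩)
  | @tail u w _ huw ih =>
    rcases ih with ih | ih
    · have huP := ih.right_mem.2
      by_cases hw : w ∈ P
      · refine .inr ⟨w, hw, ?_⟩
        have h₁ : (u, w) ∈ R := huw.1.resolve_left fun h => huP (by
          rw [(Prod.mk.inj h).1]; exact hx)
        have h₂ : ArcReach R (S ∩ Pᶜ) a u := ih.of_insert (.inl fun h => h.2 hx)
        exact (h₂.mono subset_rfl Set.inter_subset_left).tail h₁ huw.2.2
      · exact .inl (ih.tail huw.1 ⟨huw.2.2, hw⟩)
    · exact .inr ih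

lemma avoid_or_hit' (h : ArcReach (insert (x, y) R) S a b) (hy : y ∈ P) :
    ArcReach (insert (x, y) R) (S ∩ Pᶜ) a b ∨ ∃ p ∈ P, ArcReach R S p b := by
  have hs : ∀ (x y : β) (R : Set (β × β)),
      Prod.swap ⁻¹' (insert (x, y) R) = insert (y, x) (Prod.swap ⁻¹' R) := by
    intro x y R
    ext ⟨u, w⟩
    simp [and_comm]
  have h' := h.swap
  rw [hs] at h'
  rcases h'.avoid_or_hit hy with h₁ | ⟨p, hp, h₁⟩
  · have := h₁.swap
    rw [hs] at this
    exact .inl this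
  · exact .inr ⟨p, hp, h₁.swap⟩

/-- Truncation at the first vertex in `P`, with `K` the vertex set of the truncated walk. The last
clause, that every vertex of `K` is reached without meeting `P` earlier, is what later controls
intersections with other walks. -/
lemma first_hit (h : ArcReach R S a b) (hb : b ∈ P) :
    ∃ p ∈ P, ∃ K ⊆ S, ArcReach R K a p ∧ (∀ v ∈ K, v ∈ P → v = p) ∧
      ∀ v ∈ K, ArcReach R (insert v Pᶜ) a v := by
  obtain ⟨ha, h⟩ := h
  induction h using Relation.ReflTransGen.head_induction_on with
  | refl =>
    exact ⟨b, hb, {b}, by simpa, refl rfl, by simp, by simp [ArcReach.refl]⟩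
  | @head u w huw _ ih =>
    by_cases hu : u ∈ P
    · exact ⟨u, hu, {u}, by simpa, refl rfl, by simp, by simp [ArcReach.refl]⟩
    obtain ⟨p, hp, K, hKS, hK, hKP, hKr⟩ := ih huw.2.2
    refine ⟨p, hp, insert u K, Set.insert_subset huw.2.1 hKS,
      (hK.mono subset_rfl (Set.subset_insert _ _)).head huw.1 (Set.mem_insert _ _), ?_, ?_⟩
    · rintro v (rfl | hv) hvP
      · exact absurd hvP hu
      · exact hKP v hv hvP
    · rintro v (rfl | hv)
      · exact refl (Set.mem_insert _ _)
      · exact (hKr v hv).head huw.1 (.inr hu)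

lemma last_hit (h : ArcReach R S a b) (ha : a ∈ P) :
    ∃ p ∈ P, ∃ K ⊆ S, ArcReach R K p b ∧ (∀ v ∈ K, v ∈ P → v = p) ∧
      ∀ v ∈ K, ArcReach R (insert v Pᶜ) v b := by
  obtain ⟨p, hp, K, hKS, hK, hKP, hKr⟩ := h.swap.first_hit ha
  exact ⟨p, hp, K, hKS, hK.swap, hKP, fun v hv => (hKr v hv).swap⟩

end ArcReach

/-- Induction on the arcs. If deleting the arc `(x, y)` creates a separator `X` with fewer than `k`
vertices, then `X ∪ {x}` and `X ∪ {y}` separate in the full graph. Without the arc, `k` disjoint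
walks lead from `A` to `X ∪ {x}` and `k` from `X ∪ {y}` to `B`; they are glued along `X` and along
the arc. -/
theorem menger {R : Set (β × β)} (hR : R.Finite) : ∀ {A B : Set β} {k : ℕ}, A.Finite →
    (∀ X : Set β, X.Finite → ArcSep R A B X → k ≤ X.ncard) →
    ∃ K : Fin k → Set β, (∀ i j, i ≠ j → Disjoint (K i) (K j)) ∧
      ∀ i, ∃ a ∈ A, ∃ b ∈ B, ArcReach R (K i) a b := by
  induction R, hR using Set.Finite.induction_on with
  | empty =>
    intro A B k hA h
    have hAB : (A ∩ B).Finite := hA.inter_of_left B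
    have hk := h (A ∩ B) hAB (by
      rintro a ha b hb ⟨h₁, h₂⟩
      cases h₂ with
      | refl => exact h₁ ⟨ha, hb⟩
      | tail _ h => exact h.1)
    have := hAB.fintype
    obtain ⟨f⟩ : Nonempty (Fin k ↪ ↑(A ∩ B)) := by
      apply Function.Embedding.nonempty_of_card_le
      rw [Fintype.card_fin, ← Nat.card_eq_fintype_card]
      exact hk
    refine ⟨fun i => {(f i : β)}, fun i j hij => ?_, fun i => ?_⟩
    · simp only [Set.disjoint_singleton]
      exact fun h => hij (f.injective (Subtype.ext h))
    · exact ⟨f i, (f i).2.1, f i, (f i).2.2, ArcReach.refl rfl⟩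
  | @insert e R _ _ ih =>
    obtain ⟨x, y⟩ := e
    intro A B k hA h
    by_cases hk : ∀ X : Set β, X.Finite → ArcSep R A B X → k ≤ X.ncard
    · obtain ⟨K, hK, hK'⟩ := ih hA hk
      refine ⟨K, hK, fun i => ?_⟩
      obtain ⟨a, ha, b, hb, hab⟩ := hK' i
      exact ⟨a, ha, b, hb, hab.mono (Set.subset_insert _ _) subset_rfl⟩
    push Not at hk
    obtain ⟨X, hX, hXsep, hXk⟩ := hk
    have hPsep : ArcSep (insert (x, y) R) A B (insert x X) := by
      intro a ha b hb hab
      exact hXsep a ha b hb ((hab.of_insert (.inl (by simp))).mono subset_rfl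
        (Set.compl_subset_compl.2 (Set.subset_insert _ _)))
    have hQsep : ArcSep (insert (x, y) R) A B (insert y X) := by
      intro a ha b hb hab
      exact hXsep a ha b hb ((hab.of_insert (.inr (by simp))).mono subset_rfl
        (Set.compl_subset_compl.2 (Set.subset_insert _ _)))
    have hPk := h _ (hX.insert x) hPsep
    have hQk := h _ (hX.insert y) hQsep
    -- With `|X| < k ≤ |X ∪ {x}|` and the same for `y`, the set `X` has exactly `k - 1` elements, so
    -- both enlarged sets have exactly `k` and each family of walks uses all of them.
    have hxX : x ∉ X := fun hx => by
      rw [Set.insert_eq_of_mem hx] at hPk; omega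
    have hyX : y ∉ X := fun hy => by
      rw [Set.insert_eq_of_mem hy] at hQk; omega
    rw [Set.ncard_insert_of_notMem hxX hX] at hPk
    rw [Set.ncard_insert_of_notMem hyX hX] at hQk
    obtain ⟨K, hKd, hKr⟩ := ih (A := A) (B := insert x X) (k := k) hA (by
      intro Y hY hYsep
      refine h Y hY fun a ha b hb hab => ?_
      rcases hab.avoid_or_hit (Set.mem_insert x X) with h₁ | ⟨p, hp, h₁⟩
      · exact hPsep a ha b hb (h₁.mono subset_rfl Set.inter_subset_right)
      · exact hYsep a ha p hp h₁)
    obtain ⟨L, hLd, hLr⟩ := ih (A := insert y X) (B := B) (k := k) (hX.insert y) (by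
      intro Y hY hYsep
      refine h Y hY fun a ha b hb hab => ?_
      rcases hab.avoid_or_hit' (Set.mem_insert y X) with h₁ | ⟨p, hp, h₁⟩
      · exact hQsep a ha b hb (h₁.mono subset_rfl Set.inter_subset_right)
      · exact hYsep p hp b hb h₁)
    have hK' : ∀ i, ∃ a ∈ A, ∃ p ∈ insert x X, ∃ K' ⊆ K i, ArcReach R K' a p ∧
        (∀ v ∈ K', v ∈ insert x X → v = p) ∧
        ∀ v ∈ K', ArcReach R (insert v (insert x X)ᶜ) a v := by
      intro i
      obtain ⟨a, ha, p, hp, hap⟩ := hKr i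
      exact ⟨a, ha, hap.first_hit hp⟩
    have hL' : ∀ i, ∃ b ∈ B, ∃ q ∈ insert y X, ∃ L' ⊆ L i, ArcReach R L' q b ∧
        (∀ v ∈ L', v ∈ insert y X → v = q) ∧
        ∀ v ∈ L', ArcReach R (insert v (insert y X)ᶜ) v b := by
      intro i
      obtain ⟨q, hq, b, hb, hqb⟩ := hLr i
      exact ⟨b, hb, hqb.last_hit hq⟩
    choose a ha p hp K' hK'K hap hK'P hK'r using hK'
    choose b hb q hq L' hL'L hqb hL'Q hL'r using hL'
    have hp_inj : Function.Injective p := by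
      intro i j hij
      by_contra hne
      exact Set.disjoint_left.1 (hKd i j hne) (hK'K i (hap i).right_mem)
        (hij ▸ hK'K j (hap j).right_mem)
    have hq_inj : Function.Injective q := by
      intro i j hij
      by_contra hne
      exact Set.disjoint_left.1 (hLd i j hne) (hL'L i (hqb i).left_mem)
        (hij ▸ hL'L j (hqb j).left_mem)
    have hq_surj : ∀ v ∈ insert y X, ∃ j, q j = v := by
      have h₁ : Set.range q ⊆ insert y X := by rintro _ ⟨i, rfl⟩; exact hq i
      have h₂ : (insert y X).ncard ≤ (Set.range q).ncard := by
        rw [← Set.image_univ, Set.ncard_image_of_injective _ hq_inj, Set.ncard_univ,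
          Nat.card_eq_fintype_card, Fintype.card_fin, Set.ncard_insert_of_notMem hyX hX]
        omega
      have h₃ := Set.eq_of_subset_of_ncard_le h₁ h₂ (hX.insert y)
      intro v hv
      rw [← h₃] at hv
      exact hv
    -- The gluing: a walk that ends in `X` continues with the one that starts there, and the walk
    -- that ends in `x` continues through the arc with the one that starts in `y`.
    have hj : ∀ i, ∃ j, (p i = x ∧ q j = y) ∨ (p i ∈ X ∧ q j = p i) := by
      intro i
      rcases hp i with h₁ | h₁
      · obtain ⟨j, hj⟩ := hq_surj y (Set.mem_insert _ _)
        exact ⟨j, .inl ⟨h₁, hj⟩⟩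
      · obtain ⟨j, hj⟩ := hq_surj (p i) (.inr h₁)
        exact ⟨j, .inr ⟨h₁, hj⟩⟩
    choose j hj using hj
    have hj_inj : Function.Injective j := by
      intro i i' hii
      apply hp_inj
      have h₁ := hj i
      have h₂ := hj i'
      rw [hii] at h₁
      rcases h₁ with ⟨h₁, h₁'⟩ | ⟨h₁, h₁'⟩ <;> rcases h₂ with ⟨h₂, h₂'⟩ | ⟨h₂, h₂'⟩
      · rw [h₁, h₂]
      · rw [← h₂', h₁'] at h₂; exact absurd h₂ hyX
      · rw [← h₁', h₂'] at h₁; exact absurd h₁ hyX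
      · rw [← h₁', ← h₂']
    -- A common vertex outside `X` would yield a walk from `A` to `B` avoiding `X`. A common vertex
    -- in `X` is the last vertex of one walk and the first of the other, hence the two are glued
    -- together.
    have hcross : ∀ i i', i ≠ i' → Disjoint (K' i) (L' (j i')) := by
      intro i i' hne
      rw [Set.disjoint_left]
      intro v hv hv'
      have hvX : v ∈ X := by
        by_contra hvX
        refine hXsep (a i) (ha i) (b (j i')) (hb (j i')) (((hK'r i v hv).mono subset_rfl ?_).trans
          ((hL'r (j i') v hv').mono subset_rfl ?_))
        · exact Set.insert_subset hvX (Set.compl_subset_compl.2 (Set.subset_insert _ _))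
        · exact Set.insert_subset hvX (Set.compl_subset_compl.2 (Set.subset_insert _ _))
      have h₁ := hK'P i v hv (.inr hvX)
      have h₂ := hL'Q (j i') v hv' (.inr hvX)
      rcases hj i' with ⟨h₃, h₄⟩ | ⟨h₃, h₄⟩
      · rw [h₂, h₄] at hvX; exact hyX hvX
      · exact hne (hp_inj (by rw [← h₁, h₂, h₄]))
    refine ⟨fun i => K' i ∪ L' (j i), fun i i' hne => ?_, fun i => ⟨a i, ha i, b (j i), hb _, ?_⟩⟩
    · rw [Set.disjoint_union_left, Set.disjoint_union_right, Set.disjoint_union_right]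
      refine ⟨⟨(hKd i i' hne).mono (hK'K i) (hK'K i'), hcross i i' hne⟩,
        (hcross i' i hne.symm).symm, ?_⟩
      exact (hLd _ _ fun h => hne (hj_inj h)).mono (hL'L _) (hL'L _)
    · have h₁ : ArcReach (insert (x, y) R) (K' i ∪ L' (j i)) (a i) (p i) :=
        (hap i).mono (Set.subset_insert _ _) Set.subset_union_left
      have h₂ : ArcReach (insert (x, y) R) (K' i ∪ L' (j i)) (q (j i)) (b (j i)) :=
        (hqb (j i)).mono (Set.subset_insert _ _) Set.subset_union_right
      rcases hj i with ⟨h₃, h₄⟩ | ⟨h₃, h₄⟩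
      · refine (h₁.tail (c := q (j i)) ?_ h₂.left_mem).trans h₂
        rw [h₃, h₄]
        exact Set.mem_insert _ _
      · rw [h₄] at h₂
        exact h₁.trans h₂

/-! ### Paths between edge sets and separators -/

/-- Pairs of edges with a common end. -/
def edgeArcs (G : Graph α β) : Set (β × β) := {p | ∃ v, G.Inc p.1 v ∧ G.Inc p.2 v}

/-- Sequences of edges `f 0, …, f n` in `K` from `A` to `B` whose consecutive terms have a common
end. -/
def IsEdgeChain (G : Graph α β) (A B K : Set β) (n : ℕ) (f : ℕ → β) : Prop :=
  f 0 ∈ A ∧ f n ∈ B ∧ (∀ i ≤ n, f i ∈ K) ∧ ∀ i < n, (f i, f (i + 1)) ∈ edgeArcs G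

lemma exists_isEdgeChain {G : Graph α β} {A B K : Set β} {a b : β} (ha : a ∈ A) (hb : b ∈ B)
    (h : ArcReach (edgeArcs G) K a b) : ∃ n f, IsEdgeChain G A B K n f := by
  have : ∃ n f, IsEdgeChain G A {b} K n f := by
    clear hb
    obtain ⟨haK, h⟩ := h
    induction h with
    | refl => exact ⟨0, fun _ => a, ha, rfl, fun _ _ => haK, by simp⟩
    | @tail u w _ huw ih =>
      obtain ⟨n, f, h₁, h₂, h₃, h₄⟩ := ih
      refine ⟨n + 1, fun i => if i ≤ n then f i else w, by simpa, by simp, ?_, ?_⟩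
      · intro i hi
        dsimp only
        split_ifs with h
        · exact h₃ i h
        · exact huw.2.2
      · intro i hi
        dsimp only
        rw [if_pos (by omega : i ≤ n)]
        split_ifs with h
        · exact h₄ i (by omega)
        · obtain rfl : i = n := by omega
          rw [h₂]
          exact huw.1
  obtain ⟨n, f, h₁, h₂, h₃, h₄⟩ := this
  exact ⟨n, f, h₁, h₂ ▸ hb, h₃, h₄⟩

lemma IsEdgeChain.drop {G : Graph α β} {A B K : Set β} {n : ℕ} {f : ℕ → β}
    (h : IsEdgeChain G A B K n f) {i : ℕ} (hi : i ≤ n) (hA : f i ∈ A) :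
    IsEdgeChain G A B K (n - i) (fun m => f (m + i)) := by
  obtain ⟨h₁, h₂, h₃, h₄⟩ := h
  refine ⟨by simpa, ?_, fun m hm => h₃ _ (by omega), fun m hm => ?_⟩
  · dsimp only
    rwa [Nat.sub_add_cancel hi]
  · have := h₄ (m + i) (by omega)
    rwa [show m + i + 1 = m + 1 + i by omega] at this

lemma IsEdgeChain.shortcut {G : Graph α β} {A B K : Set β} {n : ℕ} {f : ℕ → β}
    (h : IsEdgeChain G A B K n f) {i j : ℕ} (hij : i < j) (hj : j ≤ n)
    (hf : (f i, f j) ∈ edgeArcs G) :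
    IsEdgeChain G A B K (n - (j - i - 1))
      (fun m => if m ≤ i then f m else f (m + (j - i - 1))) := by
  obtain ⟨h₁, h₂, h₃, h₄⟩ := h
  refine ⟨by simpa, ?_, fun m hm => ?_, fun m hm => ?_⟩
  · dsimp only
    rw [if_neg (by omega), Nat.sub_add_cancel (by omega)]
    exact h₂
  · dsimp only
    split_ifs
    · exact h₃ _ (by omega)
    · exact h₃ _ (by omega)
  · dsimp only
    rcases lt_trichotomy m i with h | rfl | h
    · rw [if_pos (by omega), if_pos (by omega)]
      exact h₄ m (by omega)
    · rw [if_pos le_rfl, if_neg (by omega), show m + 1 + (j - m - 1) = j by omega]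
      exact hf
    · rw [if_neg (by omega), if_neg (by omega),
        show m + 1 + (j - i - 1) = m + (j - i - 1) + 1 by omega]
      exact h₄ _ (by omega)

lemma isLink_of_inc_of_ne {G : Graph α β} {e : β} {x y : α} (hx : G.Inc e x) (hy : G.Inc e y)
    (hxy : x ≠ y) : G.IsLink e x y := by
  have := hy.eq_of_isLink_of_ne_left hx.isLink_other hxy.symm
  rw [this]
  exact hx.isLink_other

/-- A shortest chain from `A` to `B` is a path: by `IsEdgeChain.shortcut`, edges that are not
consecutive share no end, and no inner edge lies in `A ∪ B`. -/
theorem exists_edgePath_of_reach {G : Graph α β} [G.Loopless] {A B K : Set β} {a b : β}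
    (ha : a ∈ A) (hb : b ∈ B) (hK : K ⊆ E(G)) (h : ArcReach (edgeArcs G) K a b) :
    ∃ P : EdgePath G, P.Links A B ∧ Set.range P.edge ⊆ K := by
  classical
  have hex := exists_isEdgeChain ha hb h
  obtain ⟨f, hf⟩ := Nat.find_spec hex
  set n := Nat.find hex with hn
  have hmin : ∀ m g, IsEdgeChain G A B K m g → n ≤ m := fun m g hg => Nat.find_min' hex ⟨g, hg⟩
  clear_value n
  have hA : ∀ i, 0 < i → i ≤ n → f i ∉ A := fun i h₀ hi h => by
    have := hmin _ _ (hf.drop hi h)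
    omega
  have hB : ∀ i < n, f i ∉ B := fun i hi h => by
    have := hmin i f ⟨hf.1, h, fun m hm => hf.2.2.1 m (by omega), fun m hm => hf.2.2.2 m (by omega)⟩
    omega
  have hfar : ∀ i j, i + 2 ≤ j → j ≤ n → (f i, f j) ∉ edgeArcs G := fun i j hij hj h => by
    have := hmin _ _ (hf.shortcut (by omega) hj h)
    omega
  have hinc : ∀ i ≤ n, ∃ x, G.Inc (f i) x := fun i hi => by
    obtain ⟨x, y, hxy⟩ := Graph.exists_isLink_of_mem_edgeSet (hK (hf.2.2.1 i hi))
    exact ⟨x, hxy.inc_left⟩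
  have hne : ∀ i j, i < j → j ≤ n → f i ≠ f j := by
    intro i j hij hj h
    rcases Nat.lt_or_ge n (j + 1) with hjn | hjn
    · obtain rfl : j = n := by omega
      exact hB i hij (h ▸ hf.2.1)
    · refine hfar i (j + 1) (by omega) hjn ?_
      rw [h]
      exact hf.2.2.2 j (by omega)
  have hother : ∀ i ≤ n, ∀ x, G.Inc (f i) x → ∃ y, G.Inc (f i) y ∧ y ≠ x := fun i hi x hx =>
    ⟨hx.other, hx.inc_other, hx.isLink_other.ne.symm⟩
  have hv : ∃ v : ℕ → α, ∀ i ≤ n, G.IsLink (f i) (v i) (v (i + 1)) := by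
    have hcommon : ∀ i, ∃ x, i < n → G.Inc (f i) x ∧ G.Inc (f (i + 1)) x := fun i => by
      by_cases hi : i < n
      · obtain ⟨x, hx⟩ := hf.2.2.2 i hi
        exact ⟨x, fun _ => hx⟩
      · obtain ⟨x, -⟩ := hinc 0 (by omega)
        exact ⟨x, fun h => absurd h hi⟩
    choose c hc using hcommon
    have hlast : ∃ z, G.Inc (f n) z ∧ (0 < n → z ≠ c (n - 1)) := by
      by_cases h₀ : 0 < n
      · have := (hc (n - 1) (by omega)).2
        rw [Nat.sub_add_cancel h₀] at this
        obtain ⟨y, hy, hy'⟩ := hother n le_rfl _ this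
        exact ⟨y, hy, fun _ => hy'⟩
      · obtain ⟨x, hx⟩ := hinc n le_rfl
        exact ⟨x, hx, fun h => absurd h h₀⟩
    obtain ⟨z, hz, hz'⟩ := hlast
    -- Only for a single edge (`n = 0`) must the two extreme vertices differ. For larger `n` they
    -- may coincide, as for two parallel edges.
    have hfirst : ∃ w, G.Inc (f 0) w ∧ (0 < n → w ≠ c 0) ∧ (n = 0 → w ≠ z) := by
      by_cases h₀ : 0 < n
      · obtain ⟨y, hy, hy'⟩ := hother 0 (by omega) _ (hc 0 h₀).1
        exact ⟨y, hy, fun _ => hy', fun h => by omega⟩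
      · obtain rfl : n = 0 := by omega
        obtain ⟨y, hy, hy'⟩ := hother 0 le_rfl _ hz
        exact ⟨y, hy, fun h => by omega, fun _ => hy'⟩
    obtain ⟨w, hw, hw', hw''⟩ := hfirst
    refine ⟨fun i => if i = 0 then w else if i ≤ n then c (i - 1) else z, fun i hi => ?_⟩
    dsimp only
    rw [if_neg (by omega : i + 1 ≠ 0), Nat.add_sub_cancel]
    by_cases h₀ : i = 0
    · subst h₀
      rw [if_pos rfl]
      by_cases h₁ : 0 + 1 ≤ n
      · rw [if_pos h₁]
        exact isLink_of_inc_of_ne hw (hc 0 h₁).1 (hw' h₁)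
      · rw [if_neg h₁]
        obtain rfl : n = 0 := by omega
        exact isLink_of_inc_of_ne hw hz (hw'' rfl)
    · rw [if_neg h₀, if_pos hi]
      have hprev := (hc (i - 1) (by omega)).2
      rw [Nat.sub_add_cancel (by omega)] at hprev
      by_cases h₁ : i + 1 ≤ n
      · rw [if_pos h₁]
        refine isLink_of_inc_of_ne hprev (hc i h₁).1 fun heq => ?_
        refine hfar (i - 1) (i + 1) (by omega) h₁ ⟨c i, ?_, (hc i h₁).2⟩
        rw [← heq]
        exact (hc (i - 1) (by omega)).1
      · rw [if_neg h₁]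
        obtain rfl : i = n := by omega
        exact isLink_of_inc_of_ne hprev hz (hz' (by omega)).symm
  obtain ⟨v, hv⟩ := hv
  -- A repeated vertex, other than the two extremes, lies on two non-consecutive edges of the chain
  -- or is the two ends of one edge; the former contradicts `hfar`, the latter looplessness.
  have hvd : ∀ i j, i < j → j ≤ n + 1 → v i = v j → i = 0 ∧ j = n + 1 := by
    intro i j hij hj hvij
    by_contra hcon
    have hadj : j ≠ i + 1 := by
      rintro rfl
      exact (hv i (by omega)).ne hvij
    have hi : ∃ i' ≤ i, i ≤ i' + 1 ∧ (i' = 0 ∨ i' + 1 = i) ∧ G.Inc (f i') (v i) := by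
      rcases Nat.eq_zero_or_pos i with rfl | h
      · exact ⟨0, le_rfl, by omega, .inl rfl, (hv 0 (by omega)).inc_left⟩
      · refine ⟨i - 1, by omega, by omega, .inr (by omega), ?_⟩
        have := (hv (i - 1) (by omega)).inc_right
        rwa [Nat.sub_add_cancel h] at this
    have hj' : ∃ j' ≤ n, (j' = j ∨ (j' + 1 = j ∧ j' = n)) ∧ G.Inc (f j') (v j) := by
      rcases Nat.lt_or_ge n j with h | h
      · obtain rfl : j = n + 1 := by omega
        exact ⟨n, le_rfl, .inr ⟨rfl, rfl⟩, (hv n le_rfl).inc_right⟩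
      · exact ⟨j, h, .inl rfl, (hv j h).inc_left⟩
    obtain ⟨i', hi₁, hi₂, hi₃, hi₄⟩ := hi
    obtain ⟨j', hj₁, hj₂, hj₃⟩ := hj'
    exact hfar i' j' (by omega) hj₁ ⟨v i, hi₄, hvij ▸ hj₃⟩
  refine ⟨⟨n + 1, fun i => v i, fun i => f i, fun i => ?_, fun i j hij => ?_, fun i j hij h => ?_⟩,
    ⟨Nat.succ_pos n, hf.1, by simpa using hf.2.1, fun i h₁ h₂ h => ?_⟩, ?_⟩
  · simpa using hv i (by omega)
  · by_contra hne'
    rcases lt_or_gt_of_ne (fun h => hne' (Fin.ext h) : (i : ℕ) ≠ j) with h | h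
    · exact hne i j h (by omega) hij
    · exact hne j i h (by omega) hij.symm
  · have := hvd i j hij (by omega) h
    exact ⟨Fin.ext this.1, Fin.ext this.2⟩
  · have h₃ : (i : ℕ) < n := by simpa using h₂
    rcases h with h | h
    · exact hA i h₁ h₃.le h
    · exact hB i h₃ h
  · rintro _ ⟨i, rfl⟩
    exact hf.2.2.1 i (Nat.lt_succ_iff.1 i.2)

/-! ### Edge boundaries and vertex sets that witness separation -/

/-- The edges with exactly one end in `W`. -/
def boundary (G : Graph α β) (W : Set α) : Set β := {e | ∃ x y, G.IsLink e x y ∧ x ∈ W ∧ y ∉ W}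

lemma boundary_subset {G : Graph α β} {W : Set α} : boundary G W ⊆ E(G) := by
  rintro e ⟨x, y, h, -⟩
  exact h.edge_mem

lemma boundary_compl {G : Graph α β} (W : Set α) : boundary G Wᶜ = boundary G W := by
  ext e
  constructor <;> rintro ⟨x, y, h, hx, hy⟩
  · exact ⟨y, x, h.symm, by simpa using hy, hx⟩
  · exact ⟨y, x, h.symm, hy, by simpa using hx⟩

lemma mem_of_notMem_boundary {G : Graph α β} {W : Set α} {e : β} {x y : α}
    (he : e ∉ boundary G W) (hx : G.Inc e x) (hy : G.Inc e y) (hxW : x ∈ W) : y ∈ W := by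
  by_contra hyW
  exact he ⟨x, y, isLink_of_inc_of_ne hx hy fun h => hyW (h ▸ hxW), hxW, hyW⟩

/-- `W` is a vertex set that shows that `F` separates `A` from `B`. -/
structure Splits (G : Graph α β) (A B F : Set β) (W : Set α) : Prop where
  boundary_subset : boundary G W ⊆ F
  left : ∀ e ∈ A, e ∉ F → ∀ x, G.Inc e x → x ∈ W
  right : ∀ e ∈ B, e ∉ F → ∀ x, G.Inc e x → x ∉ W

lemma Splits.symm {G : Graph α β} {A B F : Set β} {W : Set α} (h : Splits G A B F W) :
    Splits G B A F Wᶜ :=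
  ⟨by rw [boundary_compl]; exact h.boundary_subset, h.right,
    fun e he heF x hx hxW => hxW (h.left e he heF x hx)⟩

lemma Splits.isSeparator {G : Graph α β} {A B F : Set β} {W : Set α} (h : Splits G A B F W)
    (hF : F ⊆ E(G)) : IsSeparator G A B F := by
  refine ⟨hF, ?_⟩
  rintro ⟨P, hpos, hA, hB, -⟩
  have hl : ∀ i : Fin P.length, P.edge i ∉ F ∧ G.Inc (P.edge i) (P.vertex i.castSucc) ∧
      G.Inc (P.edge i) (P.vertex i.succ) := fun i => by
    have h₁ := Graph.deleteEdges_inc.1 (P.isLink i).inc_left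
    have h₂ := Graph.deleteEdges_inc.1 (P.isLink i).inc_right
    exact ⟨h₁.2, h₁.1, h₂.1⟩
  have key : ∀ i (hi : i < P.length), P.vertex (Fin.castSucc ⟨i, hi⟩) ∈ W := by
    intro i
    induction i with
    | zero =>
      intro hi
      exact h.left _ hA (hl _).1 _ (hl ⟨0, hi⟩).2.1
    | succ i ih =>
      intro hi
      have h₁ := ih (by omega)
      have h₂ := hl ⟨i, by omega⟩
      exact mem_of_notMem_boundary (fun h' => h₂.1 (h.boundary_subset h')) h₂.2.1 h₂.2.2 h₁
  exact h.right _ hB (hl _).1 _ (hl ⟨P.length - 1, by omega⟩).2.1 (key _ _)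

/-- Take for `W` all ends of edges reachable from `A` in `G - F`. A further edge outside `F` at `W`
is reachable too, and reaching `B` would produce a linking path. -/
lemma IsSeparator.exists_splits {G : Graph α β} [G.Loopless] {A B F : Set β} (hA : A ⊆ E(G))
    (h : IsSeparator G A B F) : ∃ W, Splits G A B F W := by
  have hl : (G.deleteEdges F).Loopless := Graph.Loopless.anti Graph.deleteEdges_le
  set H := G.deleteEdges F with hH
  have hinc : ∀ e x, H.Inc e x ↔ G.Inc e x ∧ e ∉ F := fun e x => Graph.deleteEdges_inc
  have hHe : ∀ e, e ∈ E(H) ↔ e ∈ E(G) ∧ e ∉ F := fun e => by simp [hH]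
  refine ⟨{v | ∃ a ∈ A, ∃ e, ArcReach (edgeArcs H) E(H) a e ∧ H.Inc e v}, ?_, ?_, ?_⟩
  · rintro e ⟨x, y, hxy, ⟨a, ha, f, haf, hfx⟩, hy⟩
    by_contra heF
    refine hy ⟨a, ha, e, haf.tail ⟨x, hfx, ?_⟩ ?_, ?_⟩
    · exact (hinc _ _).2 ⟨hxy.inc_left, heF⟩
    · exact (hHe _).2 ⟨hxy.edge_mem, heF⟩
    · exact (hinc _ _).2 ⟨hxy.inc_right, heF⟩
  · intro e he heF x hx
    exact ⟨e, he, e, ArcReach.refl ((hHe _).2 ⟨hA he, heF⟩), (hinc _ _).2 ⟨hx, heF⟩⟩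
  · rintro e he heF x hx ⟨a, ha, f, haf, hfx⟩
    obtain ⟨P, hP, -⟩ := exists_edgePath_of_reach ha he subset_rfl
      (haf.tail ⟨x, hfx, (hinc _ _).2 ⟨hx, heF⟩⟩ ((hHe _).2 ⟨hx.edge_mem, heF⟩))
    exact h.2 ⟨P, hP⟩

lemma IsSeparator.le_ncard {G : Graph α β} {A B F : Set β} {k : ℕ} (hE : E(G).Finite)
    (h : IsSeparator G A B F) (hk : HasDisjointPaths G k A B) : k ≤ F.ncard := by
  obtain ⟨P, hP, hPd⟩ := hk
  have : ∀ i, ∃ e ∈ F, e ∈ Set.range (P i).edge := by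
    intro i
    by_contra hcon
    push Not at hcon
    refine h.2 ⟨⟨(P i).length, (P i).vertex, (P i).edge, fun j => ?_, (P i).edge_injective,
      (P i).vertex_distinct⟩, hP i⟩
    have h₁ := (P i).isLink j
    have h₂ : (P i).edge j ∉ F := fun h => hcon _ h ⟨j, rfl⟩
    rw [Graph.deleteEdges_isLink]
    exact ⟨h₁, h₂⟩
  choose f hf hf' using this
  have hinj : Function.Injective f := by
    intro i j hij
    by_contra hne
    exact Set.disjoint_left.1 (hPd i j hne) (hf' i) (hij ▸ hf' j)
  have h₁ : (Set.range f).ncard = k := by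
    rw [← Set.image_univ, Set.ncard_image_of_injective _ hinj, Set.ncard_univ,
      Nat.card_eq_fintype_card, Fintype.card_fin]
  rw [← h₁]
  exact Set.ncard_le_ncard (by rintro _ ⟨i, rfl⟩; exact hf i) (hE.subset h.1)

/-- Menger in the line graph: consecutive edges of a path are adjacent there, so a vertex separator
of the line graph, intersected with `E(G)`, is an `(A, B)`-cut, and disjoint walks contain
edge-disjoint paths. -/
theorem exists_isSeparator_of_not_hasDisjointPaths {G : Graph α β} [G.Loopless] {A B : Set β}
    {k : ℕ} (hE : E(G).Finite) (hA : A ⊆ E(G)) (h : ¬ HasDisjointPaths G k A B) :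
    ∃ F, IsSeparator G A B F ∧ F.ncard < k := by
  by_contra hcon
  push Not at hcon
  apply h
  have hR : (edgeArcs G).Finite := (hE.prod hE).subset (by
    rintro ⟨e, f⟩ ⟨v, h₁, h₂⟩
    exact ⟨h₁.edge_mem, h₂.edge_mem⟩)
  obtain ⟨K, hK, hKr⟩ := menger (A := A) (B := B) (k := k) hR (hE.subset hA) (by
    intro X hX hXsep
    refine (hcon (X ∩ E(G)) ⟨Set.inter_subset_right, ?_⟩).trans
      (Set.ncard_le_ncard Set.inter_subset_left hX)
    rintro ⟨P, hpos, hPA, hPB, -⟩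
    refine hXsep _ hPA _ hPB ?_
    have hl : ∀ i : Fin P.length, P.edge i ∈ Xᶜ ∧ G.Inc (P.edge i) (P.vertex i.castSucc) ∧
        G.Inc (P.edge i) (P.vertex i.succ) := fun i => by
      have h₁ := Graph.deleteEdges_inc.1 (P.isLink i).inc_left
      have h₂ := Graph.deleteEdges_inc.1 (P.isLink i).inc_right
      exact ⟨fun h => h₁.2 ⟨h, h₁.1.edge_mem⟩, h₁.1, h₂.1⟩
    have key : ∀ i (hi : i < P.length),
        ArcReach (edgeArcs G) Xᶜ (P.edge ⟨0, hpos⟩) (P.edge ⟨i, hi⟩) := by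
      intro i
      induction i with
      | zero => exact fun _ => ArcReach.refl (hl _).1
      | succ i ih =>
        intro hi
        exact (ih (by omega)).tail ⟨_, (hl ⟨i, by omega⟩).2.2, (hl ⟨i + 1, hi⟩).2.1⟩ (hl _).1
    exact key _ _)
  have : ∀ i, ∃ P : EdgePath G, P.Links A B ∧ Set.range P.edge ⊆ K i ∩ E(G) := by
    intro i
    obtain ⟨a, ha, b, hb, haK, hab⟩ := hKr i
    refine exists_edgePath_of_reach ha hb Set.inter_subset_right ⟨⟨haK, hA ha⟩, ?_⟩
    refine Relation.ReflTransGen.mono ?_ _ _ hab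
    rintro e f ⟨⟨v, h₁, h₂⟩, h₃, h₄⟩
    exact ⟨⟨v, h₁, h₂⟩, ⟨h₃, h₁.edge_mem⟩, ⟨h₄, h₂.edge_mem⟩⟩
  choose P hP hPK using this
  exact ⟨P, hP, fun i j hij => (hK i j hij).mono ((hPK i).trans Set.inter_subset_left)
    ((hPK j).trans Set.inter_subset_left)⟩

/-! ### Uncrossing -/

section Uncrossing

variable {G : Graph α β} {A B : Set β} {μ : ℕ} {W C : Set α}

lemma mem_edgesBetween_iff {e : β} {x y : α} (h : G.IsLink e x y) (X Y : Set α) :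
    e ∈ edgesBetween G X Y ↔ x ∈ X ∧ y ∈ Y ∨ y ∈ X ∧ x ∈ Y := by
  constructor
  · rintro ⟨x', hx', y', hy', h'⟩
    rcases h.eq_and_eq_or_eq_and_eq h' with ⟨rfl, rfl⟩ | ⟨rfl, rfl⟩
    · exact .inl ⟨hx', hy'⟩
    · exact .inr ⟨hx', hy'⟩
  · rintro (⟨hx, hy⟩ | ⟨hy, hx⟩)
    · exact ⟨x, hx, y, hy, h⟩
    · exact ⟨y, hy, x, hx, h.symm⟩

lemma mem_boundary_iff {e : β} {x y : α} (h : G.IsLink e x y) (W : Set α) :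
    e ∈ boundary G W ↔ x ∈ W ∧ y ∉ W ∨ y ∈ W ∧ x ∉ W := by
  constructor
  · rintro ⟨x', y', h', hx', hy'⟩
    rcases h.eq_and_eq_or_eq_and_eq h' with ⟨rfl, rfl⟩ | ⟨rfl, rfl⟩
    · exact .inl ⟨hx', hy'⟩
    · exact .inr ⟨hx', hy'⟩
  · rintro (⟨hx, hy⟩ | ⟨hy, hx⟩)
    · exact ⟨x, y, h, hx, hy⟩
    · exact ⟨y, x, h.symm, hy, hx⟩

lemma edgesBetween_subset {X Y : Set α} : edgesBetween G X Y ⊆ E(G) := by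
  rintro e ⟨x, -, y, -, h⟩
  exact h.edge_mem

open Classical in
lemma ncard_eq_sum_indicator (hE : E(G).Finite) {F : Set β} (hF : F ⊆ E(G)) :
    F.ncard = ∑ e ∈ hE.toFinset, if e ∈ F then 1 else 0 := by
  rw [← Finset.card_filter, ← Set.ncard_coe_finset]
  congr 1
  ext e
  simp only [Finset.coe_filter, Set.Finite.mem_toFinset, Set.mem_ofPred_eq]
  exact ⟨fun h => ⟨hF h, h⟩, fun h => h.2⟩

/-- Counted edge by edge. An edge from `C \ W` to `W \ C` lies in both boundaries on the right and
in neither on the left, which explains the factor two. -/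
lemma boundary_submodular (hE : E(G).Finite) (C W : Set α) :
    (boundary G (C ∩ W)).ncard + (boundary G (C ∪ W)).ncard +
      2 * (edgesBetween G (C \ W) (W \ C)).ncard ≤ (boundary G C).ncard + (boundary G W).ncard := by
  classical
  rw [ncard_eq_sum_indicator hE boundary_subset, ncard_eq_sum_indicator hE boundary_subset,
    ncard_eq_sum_indicator hE boundary_subset, ncard_eq_sum_indicator hE boundary_subset,
    ncard_eq_sum_indicator hE edgesBetween_subset, Finset.mul_sum, ← Finset.sum_add_distrib,
    ← Finset.sum_add_distrib, ← Finset.sum_add_distrib]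
  refine Finset.sum_le_sum fun e he => ?_
  obtain ⟨x, y, h⟩ := Graph.exists_isLink_of_mem_edgeSet (hE.mem_toFinset.1 he)
  simp only [mem_boundary_iff h, mem_edgesBetween_iff h, Set.mem_inter_iff, Set.mem_union,
    Set.mem_sdiff]
  by_cases h₁ : x ∈ C <;> by_cases h₂ : y ∈ C <;> by_cases h₃ : x ∈ W <;> by_cases h₄ : y ∈ W <;>
    simp [h₁, h₂, h₃, h₄]

lemma boundary_inter_add_diff_le (hE : E(G).Finite) (C W : Set α) :
    (boundary G (C ∩ W)).ncard + (boundary G (Cᶜ \ W)).ncard ≤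
      (boundary G C).ncard + (boundary G W).ncard := by
  have h := boundary_submodular hE C W
  rw [← boundary_compl (C ∪ W), Set.compl_union, ← Set.sdiff_eq] at h
  omega

/-- `μ` is a lower bound on the size of the edge sets that separate `A` from `B`. -/
def SplitBound (G : Graph α β) (A B : Set β) (μ : ℕ) : Prop :=
  ∀ F ⊆ E(G), ∀ W, Splits G A B F W → μ ≤ F.ncard

lemma SplitBound.symm (h : SplitBound G A B μ) : SplitBound G B A μ :=
  fun F hF W hW => h F hF Wᶜ hW.symm

/-- Every edge of `A` has an end in `W`, every edge of `B` has an end outside `W`, and at most `μ`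
edges leave `W`. -/
structure IsConfig (G : Graph α β) (A B : Set β) (μ : ℕ) (W : Set α) : Prop where
  left : ∀ e ∈ A, ∃ x ∈ W, G.Inc e x
  right : ∀ e ∈ B, ∃ x ∉ W, G.Inc e x
  card_le : (boundary G W).ncard ≤ μ

lemma IsConfig.symm (h : IsConfig G A B μ W) : IsConfig G B A μ Wᶜ :=
  ⟨h.right, fun e he => by simpa using h.left e he, by rw [boundary_compl]; exact h.card_le⟩

lemma IsConfig.splits (h : IsConfig G A B μ W) : Splits G A B (boundary G W) W := by
  refine ⟨subset_rfl, fun e he heW x hx => ?_, fun e he heW x hx hxW => ?_⟩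
  · obtain ⟨y, hy, hey⟩ := h.left e he
    exact mem_of_notMem_boundary heW hey hx hy
  · obtain ⟨y, hy, hey⟩ := h.right e he
    exact hy (mem_of_notMem_boundary heW hx hey hxW)

/-- The edges leaving `C ∪ W`, together with the set `Q` of edges from `C \ W` to `W \ C`, separate
`A` from `B`, so `μ ≤ |∂(C ∪ W)| + |Q|`. Submodularity and `|∂W| ≤ μ` then give `|∂(C ∩ W)| + |Q| ≤
|∂C|`. Equality of the boundaries forces `Q = ∅`, which makes `C ∪ W` a configuration as well. -/
lemma IsConfig.inter_le (hE : E(G).Finite) (h : IsConfig G A B μ W) (hμ : SplitBound G A B μ)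
    (hC : ∀ e ∈ B, ∃ x ∉ C, G.Inc e x) :
    (boundary G (C ∩ W)).ncard ≤ (boundary G C).ncard ∧
      ((boundary G C).ncard ≤ (boundary G (C ∩ W)).ncard → IsConfig G A B μ (C ∪ W)) := by
  have hsub := boundary_submodular hE C W
  set Q := edgesBetween G (C \ W) (W \ C) with hQ
  -- An edge of `B` has an end outside `C` and an end outside `W`; if neither end avoids the union,
  -- the edge lies in `Q`.
  have hright : ∀ e ∈ B, e ∉ Q → ∃ x ∉ C ∪ W, G.Inc e x := by
    intro e he heQ
    obtain ⟨x, hx, hex⟩ := hC e he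
    obtain ⟨y, hy, hey⟩ := h.right e he
    by_cases hxW : x ∈ W
    · by_cases hyC : y ∈ C
      · exact absurd ⟨y, ⟨hyC, hy⟩, x, ⟨hxW, hx⟩,
          isLink_of_inc_of_ne hey hex fun h => hx (h ▸ hyC)⟩ heQ
      · exact ⟨y, by simp [hy, hyC], hey⟩
    · exact ⟨x, by simp [hx, hxW], hex⟩
  have hleft : ∀ e ∈ A, ∃ x ∈ C ∪ W, G.Inc e x := fun e he => by
    obtain ⟨x, hx, hex⟩ := h.left e he
    exact ⟨x, .inr hx, hex⟩
  have hbound : μ ≤ (boundary G (C ∪ W) ∪ Q).ncard := by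
    refine hμ _ (Set.union_subset boundary_subset edgesBetween_subset) (C ∪ W)
      ⟨Set.subset_union_left, fun e he heF x hx => ?_, fun e he heF x hx hxW => ?_⟩
    · obtain ⟨y, hy, hey⟩ := hleft e he
      exact mem_of_notMem_boundary (fun h => heF (.inl h)) hey hx hy
    · obtain ⟨y, hy, hey⟩ := hright e he fun h => heF (.inr h)
      exact hy (mem_of_notMem_boundary (fun h => heF (.inl h)) hx hey hxW)
  have hbound' := hbound.trans (Set.ncard_union_le _ _)
  have hcard := h.card_le
  refine ⟨by omega, fun heq => ?_⟩
  have hQ0 : Q.ncard = 0 := by omega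
  have hQe : Q = ∅ := (Set.ncard_eq_zero (hE.subset edgesBetween_subset)).1 hQ0
  exact ⟨hleft, fun e he => hright e he (by simp [hQe]), by omega⟩

lemma IsConfig.diff_le (hE : E(G).Finite) (h : IsConfig G A B μ W) (hμ : SplitBound G A B μ)
    (hC : ∀ e ∈ A, ∃ x ∉ C, G.Inc e x) :
    (boundary G (C \ W)).ncard ≤ (boundary G C).ncard ∧
      ((boundary G C).ncard ≤ (boundary G (C \ W)).ncard → IsConfig G A B μ (W \ C)) := by
  have h' := h.symm.inter_le hE hμ.symm hC
  rw [← Set.sdiff_eq] at h'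
  refine ⟨h'.1, fun heq => ?_⟩
  have := (h'.2 heq).symm
  rwa [Set.compl_union, compl_compl, Set.inter_comm, ← Set.sdiff_eq] at this

/-- In the equality case `C ∪ W` is a configuration. Every edge of `B` has an end in `C` and an end
outside `C ∪ W`, so `B` lies in a boundary of at most `μ` edges, contrary to `μ < |B|`. -/
lemma IsConfig.inter_lt (hE : E(G).Finite) (h : IsConfig G A B μ W) (hμ : SplitBound G A B μ)
    (hB : B ⊆ boundary G C) (hcard : μ < B.ncard) :
    (boundary G (C ∩ W)).ncard < (boundary G C).ncard := by
  by_contra hcon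
  have h' := (h.inter_le (C := C) hE hμ fun e he => by
    obtain ⟨x, y, hxy, -, hy⟩ := hB he
    exact ⟨y, hy, hxy.inc_right⟩).2 (not_lt.1 hcon)
  refine absurd (Set.ncard_le_ncard (fun e he => ?_) (hE.subset boundary_subset))
    (not_le.2 (h'.card_le.trans_lt hcard))
  obtain ⟨x, y, hxy, hx, -⟩ := hB he
  obtain ⟨z, hz, hez⟩ := h'.right e he
  exact ⟨x, z, isLink_of_inc_of_ne hxy.inc_left hez fun h => hz (.inl (h ▸ hx)), .inl hx, hz⟩

lemma IsConfig.diff_lt (hE : E(G).Finite) (h : IsConfig G A B μ W) (hμ : SplitBound G A B μ)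
    (hA : A ⊆ boundary G C) (hcard : μ < A.ncard) :
    (boundary G (C \ W)).ncard < (boundary G C).ncard :=
  h.symm.inter_lt hE hμ.symm hA hcard

/-- A configuration can be chosen such that every member of a laminar family is either uncrossed or
cut into two pieces of smaller boundary. -/
lemma IsConfig.exists_uncrossed {ι : Type*} [Finite ι] (hE : E(G).Finite)
    (h : IsConfig G A B μ W) (hμ : SplitBound G A B μ) (C : ι → Set α)
    (hCA : ∀ i, ∀ e ∈ A, ∃ x ∉ C i, G.Inc e x) (hCB : ∀ i, ∀ e ∈ B, ∃ x ∉ C i, G.Inc e x)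
    (hlam : ∀ i j, C i ⊆ C j ∨ C j ⊆ C i ∨ Disjoint (C i) (C j)) :
    ∃ W, IsConfig G A B μ W ∧ ∀ i, C i ⊆ W ∨ Disjoint (C i) W ∨
      (boundary G (C i ∩ W)).ncard < (boundary G (C i)).ncard ∧
      (boundary G (C i \ W)).ncard < (boundary G (C i)).ncard := by
  -- The induction is on the number of crossed members. If a crossed `C i` has a piece whose
  -- boundary is not smaller, the equality case of uncrossing allows `W` to be replaced by `W \ C i`
  -- or `C i ∪ W`; laminarity ensures that no new member becomes crossed.
  let crossed : Set α → Set ι := fun W => {i | ¬ C i ⊆ W ∧ ¬ Disjoint (C i) W}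
  induction hn : (crossed W).ncard using Nat.strong_induction_on generalizing W with
  | _ n ih =>
    by_cases hgood : ∀ i, C i ⊆ W ∨ Disjoint (C i) W ∨
      (boundary G (C i ∩ W)).ncard < (boundary G (C i)).ncard ∧
      (boundary G (C i \ W)).ncard < (boundary G (C i)).ncard
    · exact ⟨W, h, hgood⟩
    push Not at hgood
    obtain ⟨i, h₁, h₂, h₃⟩ := hgood
    have step : ∀ W', i ∉ crossed W' → crossed W' ⊆ crossed W → (crossed W').ncard < n := by
      intro W' hi hsub
      rw [← hn]
      exact Set.ncard_lt_ncard (Set.ssubset_iff_of_subset hsub |>.2 ⟨i, ⟨h₁, h₂⟩, hi⟩)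
        (Set.toFinite _)
    by_cases hlt : (boundary G (C i ∩ W)).ncard < (boundary G (C i)).ncard
    · refine ih _ (step (W \ C i) (fun hi => hi.2 Set.disjoint_sdiff_right) ?_)
        ((h.diff_le hE hμ (hCA i)).2 (h₃ hlt)) rfl
      rintro j ⟨hj₁, hj₂⟩
      refine ⟨fun hj => ?_, fun hj => hj₂ (hj.mono_right Set.sdiff_subset)⟩
      rcases hlam i j with hij | hij | hij
      · exact h₁ (hij.trans hj)
      · exact hj₂ (Set.disjoint_sdiff_right.mono_left hij)
      · exact hj₁ (Set.subset_sdiff.2 ⟨hj, hij.symm⟩)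
    · refine ih _ (step (C i ∪ W) (fun hi => hi.1 Set.subset_union_left) ?_)
        ((h.inter_le hE hμ (hCB i)).2 (not_lt.1 hlt)) rfl
      rintro j ⟨hj₁, hj₂⟩
      refine ⟨fun hj => hj₁ (hj.trans Set.subset_union_right), fun hj => ?_⟩
      rcases hlam i j with hij | hij | hij
      · exact h₂ (hj.mono_left hij)
      · exact hj₁ (hij.trans Set.subset_union_left)
      · exact hj₂ (Set.disjoint_union_right.2 ⟨hij.symm, hj⟩)

end Uncrossing

/-! ### Sides of the links of a tree -/

section Sides

variable {N : Type*} {T : SimpleGraph N} {c c' r : Sym2 N} {S S' : Set N}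

/-- `S` is one of the two components of `T - c`, where `c` is a link of the tree `T`. -/
structure IsSide (T : SimpleGraph N) (c : Sym2 N) (S : Set N) : Prop where
  exists_ends : ∃ x y, c = s(x, y) ∧ T.Adj x y ∧ x ∈ S ∧ y ∉ S
  mem_iff_of_adj : ∀ u v, T.Adj u v → s(u, v) ≠ c → (u ∈ S ↔ v ∈ S)

lemma IsSide.mem_edgeSet (h : IsSide T c S) : c ∈ T.edgeSet := by
  obtain ⟨x, y, rfl, hxy, -⟩ := h.exists_ends
  exact hxy

lemma IsSide.compl (h : IsSide T c S) : IsSide T c Sᶜ := by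
  obtain ⟨x, y, rfl, hxy, hx, hy⟩ := h.exists_ends
  exact ⟨⟨y, x, Sym2.eq_swap, hxy.symm, hy, by simpa⟩,
    fun u v huv hne => not_congr (h.mem_iff_of_adj u v huv hne)⟩

lemma IsSide.mem_iff_of_reachable (h : IsSide T c S) {u v : N}
    (huv : (T.deleteEdges {c}).Reachable u v) : u ∈ S ↔ v ∈ S := by
  obtain ⟨p⟩ := huv
  induction p with
  | nil => rfl
  | cons hadj _ ih =>
    rw [SimpleGraph.deleteEdges_adj] at hadj
    exact (h.mem_iff_of_adj _ _ hadj.1 hadj.2).trans ih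

lemma exists_isSide (hT : T.IsAcyclic) {x y : N} (hxy : T.Adj x y) :
    ∃ S, IsSide T s(x, y) S ∧ x ∈ S ∧ y ∉ S := by
  have hb := SimpleGraph.isBridge_iff.1 (SimpleGraph.isAcyclic_iff_forall_adj_isBridge.1 hT hxy)
  refine ⟨{t | (T.deleteEdges {s(x, y)}).Reachable x t},
    ⟨⟨x, y, rfl, hxy, SimpleGraph.Reachable.refl _, hb⟩, fun u v huv hne => ?_⟩,
    SimpleGraph.Reachable.refl _, hb⟩
  have hadj : (T.deleteEdges {s(x, y)}).Adj u v := by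
    rw [SimpleGraph.deleteEdges_adj]
    exact ⟨huv, hne⟩
  exact ⟨fun h => h.trans hadj.reachable, fun h => h.trans hadj.symm.reachable⟩

lemma isAcyclic_of_forall_exists_isSide (h : ∀ x y, T.Adj x y → ∃ S, IsSide T s(x, y) S) :
    T.IsAcyclic := by
  refine SimpleGraph.isAcyclic_iff_forall_adj_isBridge.2 fun x y hxy => ?_
  rw [SimpleGraph.isBridge_iff]
  intro hr
  obtain ⟨S, hS⟩ := h x y hxy
  have hiff := hS.mem_iff_of_reachable hr
  obtain ⟨u, v, huv, -, hu, hv⟩ := hS.exists_ends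
  rcases Sym2.eq_iff.1 huv with ⟨rfl, rfl⟩ | ⟨rfl, rfl⟩
  · exact hv (hiff.1 hu)
  · exact hv (hiff.2 hu)

lemma IsSide.reachable_iff (hT : T.Connected) (h : IsSide T c S) {u v : N} :
    (T.deleteEdges {c}).Reachable u v ↔ (u ∈ S ↔ v ∈ S) := by
  refine ⟨h.mem_iff_of_reachable, fun huv => ?_⟩
  obtain ⟨x, y, rfl, hxy, hx, hy⟩ := h.exists_ends
  have key : ∀ u z, T.Walk u z → z = x → (u ∈ S → (T.deleteEdges {s(x, y)}).Reachable u x) ∧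
      (u ∉ S → (T.deleteEdges {s(x, y)}).Reachable u y) := by
    intro u z p
    induction p with
    | nil => rintro rfl; exact ⟨fun _ => .refl _, fun h => absurd hx h⟩
    | @cons u w z hadj _ ih =>
      intro hz
      by_cases hc : s(u, w) = s(x, y)
      · rcases Sym2.eq_iff.1 hc with ⟨rfl, rfl⟩ | ⟨rfl, rfl⟩
        · exact ⟨fun _ => .refl _, fun h => absurd hx h⟩
        · exact ⟨fun h => absurd h hy, fun _ => .refl _⟩
      · have hadj' : (T.deleteEdges {s(x, y)}).Adj u w := by
          rw [SimpleGraph.deleteEdges_adj]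
          exact ⟨hadj, hc⟩
        have hiff := h.mem_iff_of_adj _ _ hadj hc
        exact ⟨fun hu => hadj'.reachable.trans ((ih hz).1 (hiff.1 hu)),
          fun hu => hadj'.reachable.trans ((ih hz).2 fun hw => hu (hiff.2 hw))⟩
  obtain ⟨p⟩ := hT.preconnected u x
  obtain ⟨q⟩ := hT.preconnected v x
  by_cases hu : u ∈ S
  · exact ((key u x p rfl).1 hu).trans ((key v x q rfl).1 (huv.1 hu)).symm
  · exact ((key u x p rfl).2 hu).trans ((key v x q rfl).2 fun hv => hu (huv.2 hv)).symm

lemma IsSide.eq_or_eq_compl (hT : T.Connected) (h : IsSide T c S) (h' : IsSide T c S') :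
    S' = S ∨ S' = Sᶜ := by
  have hiff : ∀ u v, (u ∈ S ↔ v ∈ S) ↔ (u ∈ S' ↔ v ∈ S') := fun u v =>
    (h.reachable_iff hT).symm.trans (h'.reachable_iff hT)
  obtain ⟨x, -, -, -, hx, -⟩ := h.exists_ends
  by_cases hx' : x ∈ S'
  · left
    ext u
    have := hiff u x
    tauto
  · right
    ext u
    have := hiff u x
    rw [Set.mem_compl_iff]
    tauto

/-- `S` is connected in `T - c`, and a walk inside `S` never uses `c'`, which has no end in `S`;
hence it cannot leave or enter `S'`. -/
lemma IsSide.subset_or_disjoint (hT : T.Connected) (h : IsSide T c S) (h' : IsSide T c' S')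
    (hc : ∀ t ∈ c', t ∉ S) : S ⊆ S' ∨ Disjoint S S' := by
  have key : ∀ u v, (T.deleteEdges {c}).Reachable u v → u ∈ S → (u ∈ S' ↔ v ∈ S') := by
    rintro u v ⟨p⟩
    induction p with
    | nil => exact fun _ => Iff.rfl
    | @cons u w z hadj _ ih =>
      intro hu
      rw [SimpleGraph.deleteEdges_adj] at hadj
      have hw := (h.mem_iff_of_adj _ _ hadj.1 hadj.2).1 hu
      refine (h'.mem_iff_of_adj _ _ hadj.1 ?_).trans (ih hw)
      rintro rfl
      exact hc u (Sym2.mem_mk_left _ _) hu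
  obtain ⟨x, -, -, -, hx, -⟩ := h.exists_ends
  have hS : ∀ u ∈ S, (x ∈ S' ↔ u ∈ S') := fun u hu =>
    key x u ((h.reachable_iff hT).2 (by simp [hx, hu])) hx
  by_cases hx' : x ∈ S'
  · exact .inl fun u hu => (hS u hu).1 hx'
  · exact .inr (Set.disjoint_left.2 fun u hu hu' => hx' ((hS u hu).2 hu'))

lemma IsSide.forall_notMem (h : IsSide T c S) (hr : r ∈ T.edgeSet) (hne : r ≠ c)
    (hS : ∃ t ∈ r, t ∉ S) : ∀ t ∈ r, t ∉ S := by
  obtain ⟨t, ht, htS⟩ := hS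
  intro t' ht' ht'S
  obtain ⟨u, rfl⟩ := Sym2.mem_iff_exists.1 ht
  rcases Sym2.mem_iff.1 ht' with rfl | rfl
  · exact htS ht'S
  · exact htS ((h.mem_iff_of_adj _ _ hr hne).2 ht'S)

/-- Sides of links of a tree never cross, and the common link `r`, an end of which each side misses,
rules out that two sides overlap and cover the tree. It serves as a root. -/
lemma IsSide.laminar (hT : T.Connected) (h : IsSide T c S) (h' : IsSide T c' S')
    (hr : r ∈ T.edgeSet) (hS : ∃ t ∈ r, t ∉ S) (hS' : ∃ t ∈ r, t ∉ S') :
    S ⊆ S' ∨ S' ⊆ S ∨ Disjoint S S' := by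
  by_cases hcc : c' = c
  · subst hcc
    rcases h.eq_or_eq_compl hT h' with rfl | rfl
    · exact .inl subset_rfl
    · exact .inr (.inr disjoint_compl_right)
  by_cases hout : ∃ t ∈ c', t ∉ S
  · rcases h.subset_or_disjoint hT h' (h.forall_notMem h'.mem_edgeSet hcc hout) with h₁ | h₁
    · exact .inl h₁
    · exact .inr (.inr h₁)
  push Not at hout
  rcases h.compl.subset_or_disjoint hT h' (fun t ht => by simpa using hout t ht) with h₁ | h₁
  · exfalso
    have h₂ : ∀ t, t ∉ S → t ∈ S' := fun t ht => h₁ ht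
    obtain ⟨t, ht, htS⟩ := hS
    obtain ⟨t', ht', htS'⟩ := hS'
    -- Here `S ∪ S'` is everything. If `r ≠ c`, both ends of `r` avoid `S` and so lie in `S'`; the
    -- symmetric argument gives `r = c'`, contrary to `c' ≠ c`.
    have hrc : r = c := by
      by_contra hne
      exact htS' (h₂ _ (h.forall_notMem hr hne ⟨t, ht, htS⟩ t' ht'))
    have hrc' : r = c' := by
      by_contra hne
      exact h'.forall_notMem hr hne ⟨t', ht', htS'⟩ t ht (h₂ t htS)
    exact hcc (hrc'.symm.trans hrc)
  · refine .inr (.inl fun t ht => ?_)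
    by_contra htS
    exact Set.disjoint_left.1 h₁ htS ht

end Sides

/-! ### Subdivision -/

section Subdivide

variable {N : Type*} {T : SimpleGraph N} {r : Sym2 N} {s t : N}

@[simp] lemma subdivide_adj_some_some :
    (subdivide T r).Adj (some s) (some t) ↔ T.Adj s t ∧ s(s, t) ≠ r := by
  simp only [subdivide, SimpleGraph.fromRel_adj]
  constructor
  · rintro ⟨-, h | h⟩
    · exact h
    · exact ⟨h.1.symm, by rw [Sym2.eq_swap]; exact h.2⟩
  · exact fun h => ⟨fun h' => h.1.ne (Option.some.inj h'), .inl h⟩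

@[simp] lemma subdivide_adj_none_some : (subdivide T r).Adj none (some t) ↔ t ∈ r := by
  simp [subdivide, SimpleGraph.fromRel_adj]

@[simp] lemma subdivide_adj_some_none : (subdivide T r).Adj (some t) none ↔ t ∈ r := by
  rw [SimpleGraph.adj_comm, subdivide_adj_none_some]

/-- The link of `T` that contains the link `xy` of the tree obtained from `T` by subdividing `r`. -/
def subdivideProj (r : Sym2 N) : Option N → Option N → Sym2 N
  | some s, some t => s(s, t)
  | _, _ => r

lemma subdivideProj_comm (r : Sym2 N) (x y : Option N) :
    subdivideProj r x y = subdivideProj r y x := by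
  cases x <;> cases y <;> simp [subdivideProj, Sym2.eq_swap]

lemma eq_of_subdivideProj_eq {x y x' y' : Option N} (h : (subdivide T r).Adj x y)
    (h' : (subdivide T r).Adj x' y') (heq : subdivideProj r x y = subdivideProj r x' y')
    (hr : subdivideProj r x y ≠ r) : s(x, y) = s(x', y') := by
  cases x <;> cases y <;> cases x' <;> cases y' <;> simp_all [subdivideProj]

/-- Of the two sides, the one without the subdivision node is chosen. It is then the same node set
in `T` and in the subdivided tree, and it avoids `r` unless the link is a half of `r`. -/
lemma IsSide.of_subdivide (hT : T.IsAcyclic) (hr : r ∈ T.edgeSet) {x y : Option N}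
    (h : (subdivide T r).Adj x y) :
    ∃ S, IsSide T (subdivideProj r x y) S ∧ IsSide (subdivide T r) s(x, y) (some '' S) ∧
      (subdivideProj r x y ≠ r → ∀ t ∈ r, t ∉ S) := by
  have hnone : ∀ t, t ∈ r → ∃ S, IsSide T r S ∧
      IsSide (subdivide T r) s(none, some t) (some '' S) := by
    intro t ht
    obtain ⟨t', rfl⟩ := Sym2.mem_iff_exists.1 ht
    obtain ⟨S, hS, htS, ht'S⟩ := exists_isSide hT (T.mem_edgeSet.1 hr)
    have haux : ∀ u, (subdivide T s(t, t')).Adj none (some u) →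
        s(none, some u) ≠ s(none, some t) → u ∉ S := fun u hu hne huS => by
      rcases Sym2.mem_iff.1 (subdivide_adj_none_some.1 hu) with rfl | rfl
      · exact hne rfl
      · exact ht'S huS
    refine ⟨S, hS, ⟨some t, none, Sym2.eq_swap, subdivide_adj_some_none.2 ht, ⟨t, htS, rfl⟩,
      by simp⟩, ?_⟩
    rintro (_ | u) (_ | v) huv hne
    · rfl
    · have := haux v huv hne
      simpa
    · have := haux u huv.symm (by rwa [Sym2.eq_swap])
      simpa
    · have := hS.mem_iff_of_adj u v (subdivide_adj_some_some.1 huv).1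
        (subdivide_adj_some_some.1 huv).2
      simpa
  cases x with
  | none =>
    cases y with
    | none => exact absurd rfl h.ne
    | some t =>
      obtain ⟨S, hS, hS'⟩ := hnone t (subdivide_adj_none_some.1 h)
      exact ⟨S, hS, hS', fun h => absurd rfl h⟩
  | some s =>
    cases y with
    | none =>
      obtain ⟨S, hS, hS'⟩ := hnone s (subdivide_adj_some_none.1 h)
      exact ⟨S, hS, by rwa [Sym2.eq_swap], fun h => absurd rfl h⟩
    | some t =>
      obtain ⟨hst, hne⟩ := subdivide_adj_some_some.1 h
      have : ∃ S, IsSide T s(s, t) S ∧ ∀ z ∈ r, z ∉ S := by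
        obtain ⟨S, hS, -⟩ := exists_isSide hT hst
        by_cases hout : ∃ z ∈ r, z ∉ S
        · exact ⟨S, hS, hS.forall_notMem hr hne.symm hout⟩
        · push Not at hout
          exact ⟨Sᶜ, hS.compl, fun z hz => by simpa using hout z hz⟩
      obtain ⟨S, hS, hrS⟩ := this
      refine ⟨S, hS, ⟨?_, ?_⟩, fun _ => hrS⟩
      · obtain ⟨x, y, hxy, -, hx, hy⟩ := hS.exists_ends
        refine ⟨some x, some y, ?_, ?_, ⟨x, hx, rfl⟩, by simpa⟩
        · rcases Sym2.eq_iff.1 hxy with ⟨rfl, rfl⟩ | ⟨rfl, rfl⟩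
          · rfl
          · exact Sym2.eq_swap
        · rcases Sym2.eq_iff.1 hxy with ⟨rfl, rfl⟩ | ⟨rfl, rfl⟩
          · exact h
          · exact h.symm
      · rintro (_ | u) (_ | v) huv hne'
        · rfl
        · have := hrS v (subdivide_adj_none_some.1 huv)
          simpa
        · have := hrS u (subdivide_adj_some_none.1 huv)
          simpa
        · have := hS.mem_iff_of_adj u v (subdivide_adj_some_some.1 huv).1 fun h' => hne' (by
            rcases Sym2.eq_iff.1 h' with ⟨rfl, rfl⟩ | ⟨rfl, rfl⟩
            · rfl
            · exact Sym2.eq_swap)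
          simpa

lemma subdivide_connected (hT : T.Connected) (hr : r ∈ T.edgeSet) :
    (subdivide T r).Connected := by
  have hnone : ∀ t ∈ r, (subdivide T r).Reachable (some t) none := fun t ht =>
    (subdivide_adj_some_none.2 ht).reachable
  have hsome : ∀ s t, T.Reachable s t → (subdivide T r).Reachable (some s) (some t) := by
    rintro s t ⟨p⟩
    induction p with
    | nil => exact .refl _
    | @cons u v w huv _ ih =>
      refine SimpleGraph.Reachable.trans ?_ ih
      by_cases h : s(u, v) = r
      · exact (hnone u (h ▸ Sym2.mem_mk_left u v)).trans (hnone v (h ▸ Sym2.mem_mk_right u v)).symm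
      · exact (subdivide_adj_some_some.2 ⟨huv, h⟩).reachable
  induction r using Sym2.ind with
  | _ p q =>
    have hp := hnone p (Sym2.mem_mk_left p q)
    refine (SimpleGraph.connected_iff_exists_forall_reachable _).2 ⟨none, ?_⟩
    rintro (_ | t)
    · exact .refl _
    · exact hp.symm.trans (hsome p t (hT.preconnected p t))

end Subdivide

namespace TreeCutDecomposition

variable {G : Graph α β} (D : TreeCutDecomposition G)

/-! ### Bags and adhesions -/

/-- The union of the bags of the nodes in `S`. -/
def bagUnion (S : Set D.Node) : Set α := ⋃ t ∈ S, D.bag t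

variable {D}

lemma mem_bagUnion {S : Set D.Node} {x : α} : x ∈ D.bagUnion S ↔ ∃ t ∈ S, x ∈ D.bag t := by
  simp [bagUnion]

lemma bag_subset (t : D.Node) : D.bag t ⊆ V(G) := by
  rw [← D.iUnion_bag]
  exact Set.subset_iUnion D.bag t

lemma exists_mem_bag {x : α} (hx : x ∈ V(G)) : ∃ t, x ∈ D.bag t := by
  rw [← D.iUnion_bag] at hx
  exact Set.mem_iUnion.1 hx

lemma eq_of_mem_bag {x : α} {s t : D.Node} (hs : x ∈ D.bag s) (ht : x ∈ D.bag t) : s = t := by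
  by_contra h
  exact Set.disjoint_left.1 (D.disjoint_bag s t h) hs ht

lemma mem_bagUnion_iff {S : Set D.Node} {x : α} {t : D.Node} (ht : x ∈ D.bag t) :
    x ∈ D.bagUnion S ↔ t ∈ S := by
  rw [mem_bagUnion]
  exact ⟨fun ⟨s, hs, hx⟩ => eq_of_mem_bag hx ht ▸ hs, fun h => ⟨t, h, ht⟩⟩

lemma bagUnion_subset (S : Set D.Node) : D.bagUnion S ⊆ V(G) :=
  Set.iUnion₂_subset fun t _ => bag_subset t

lemma bagUnion_mono {S S' : Set D.Node} (h : S ⊆ S') : D.bagUnion S ⊆ D.bagUnion S' :=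
  Set.biUnion_subset_biUnion_left h

lemma bagUnion_disjoint {S S' : Set D.Node} (h : Disjoint S S') :
    Disjoint (D.bagUnion S) (D.bagUnion S') := by
  refine Set.disjoint_left.2 fun x hx hx' => ?_
  obtain ⟨t, ht, hxt⟩ := mem_bagUnion.1 hx
  exact Set.disjoint_left.1 h ht ((mem_bagUnion_iff hxt).1 hx')

lemma bagUnion_compl (S : Set D.Node) : D.bagUnion Sᶜ = V(G) \ D.bagUnion S := by
  ext x
  constructor
  · intro hx
    refine ⟨bagUnion_subset _ hx, fun hx' => ?_⟩
    exact Set.disjoint_left.1 (bagUnion_disjoint disjoint_compl_right) hx' hx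
  · rintro ⟨hx, hx'⟩
    obtain ⟨t, ht⟩ := D.exists_mem_bag hx
    exact (mem_bagUnion_iff ht).2 fun h => hx' ((mem_bagUnion_iff ht).2 h)

/-- The bridge between the tree and the graph, through which uncrossing of vertex sets applies to
adhesions. -/
lemma adhesion_eq_boundary {c : Sym2 D.Node} {S : Set D.Node} (h : IsSide D.tree c S) :
    D.adhesion c = boundary G (D.bagUnion S) := by
  ext e
  constructor
  · rintro ⟨s, t, hst, x, hx, y, hy, hxy⟩
    rw [h.reachable_iff D.isTree.connected] at hst
    rw [mem_boundary_iff hxy, mem_bagUnion_iff hx, mem_bagUnion_iff hy]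
    tauto
  · rintro ⟨x, y, hxy, hx, hy⟩
    obtain ⟨s, hs⟩ := D.exists_mem_bag hxy.left_mem
    obtain ⟨t, ht⟩ := D.exists_mem_bag hxy.right_mem
    refine ⟨s, t, ?_, x, hs, y, ht, hxy⟩
    rw [h.reachable_iff D.isTree.connected]
    rw [mem_bagUnion_iff hs] at hx
    rw [mem_bagUnion_iff ht] at hy
    tauto

lemma adhesion_subset {c : Sym2 D.Node} : D.adhesion c ⊆ E(G) := by
  rintro e ⟨s, t, -, he⟩
  exact edgesBetween_subset he

lemma exists_inc_notMem_bagUnion {c r : Sym2 D.Node} {S : Set D.Node} (hr : r ∈ D.tree.edgeSet)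
    (h : IsSide D.tree c S) (hS : ∃ t ∈ r, t ∉ S) {e : β} (he : e ∈ D.adhesion r) :
    ∃ x ∉ D.bagUnion S, G.Inc e x := by
  by_cases hne : r = c
  · subst hne
    rw [adhesion_eq_boundary h] at he
    obtain ⟨x, y, hxy, -, hy⟩ := he
    exact ⟨y, hy, hxy.inc_right⟩
  · obtain ⟨S', hS'⟩ : ∃ S', IsSide D.tree r S' := by
      induction r using Sym2.ind with
      | _ p q =>
        obtain ⟨S', hS', -⟩ := exists_isSide D.isTree.isAcyclic (D.tree.mem_edgeSet.1 hr)
        exact ⟨S', hS'⟩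
    rw [adhesion_eq_boundary hS'] at he
    obtain ⟨x, y, hxy, hx, hy⟩ := he
    rcases h.subset_or_disjoint D.isTree.connected hS' (h.forall_notMem hr hne hS) with h₁ | h₁
    · exact ⟨y, fun hyS => hy (bagUnion_mono h₁ hyS), hxy.inc_right⟩
    · exact ⟨x, fun hxS => Set.disjoint_left.1 (bagUnion_disjoint h₁) hxS hx, hxy.inc_left⟩

end TreeCutDecomposition

lemma boundary_congr {G : Graph α β} {W W' : Set α} (h : ∀ x ∈ V(G), x ∈ W ↔ x ∈ W') :
    boundary G W = boundary G W' := by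
  ext e
  constructor <;> rintro ⟨x, y, hxy, hx, hy⟩
  · exact ⟨x, y, hxy, (h x hxy.left_mem).1 hx, fun h' => hy ((h y hxy.right_mem).2 h')⟩
  · exact ⟨x, y, hxy, (h x hxy.left_mem).2 hx, fun h' => hy ((h y hxy.right_mem).1 h')⟩

namespace TreeCutDecomposition

variable {G : Graph α β} {D : TreeCutDecomposition G} {a b : Sym2 D.Node}

/-! ### The segregation -/

section SegregationTree

@[simp] lemma segregationTree_adj_inl_inl {x y : Option D.Node} :
    (D.segregationTree a b).Adj (.inl x) (.inl y) ↔ (subdivide D.tree b).Adj x y := by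
  simp [segregationTree, SimpleGraph.edge_adj]

@[simp] lemma segregationTree_adj_inr_inr {x y : Option D.Node} :
    (D.segregationTree a b).Adj (.inr x) (.inr y) ↔ (subdivide D.tree a).Adj x y := by
  simp [segregationTree, SimpleGraph.edge_adj]

@[simp] lemma segregationTree_adj_inl_inr {x y : Option D.Node} :
    (D.segregationTree a b).Adj (.inl x) (.inr y) ↔ x = none ∧ y = none := by
  simp [segregationTree, SimpleGraph.edge_adj]

@[simp] lemma segregationTree_adj_inr_inl {x y : Option D.Node} :
    (D.segregationTree a b).Adj (.inr y) (.inl x) ↔ x = none ∧ y = none := by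
  rw [SimpleGraph.adj_comm, segregationTree_adj_inl_inr]

lemma isSide_inl {x y : Option D.Node} {S : Set D.Node}
    (h : IsSide (subdivide D.tree b) s(x, y) (some '' S)) :
    IsSide (D.segregationTree a b) s(.inl x, .inl y) (Sum.inl '' (some '' S)) := by
  have key : ∀ u : Option D.Node,
      (Sum.inl u : Option D.Node ⊕ Option D.Node) ∈ Sum.inl '' (some '' S) ↔ u ∈ some '' S :=
    fun u => Sum.inl_injective.mem_set_image
  refine ⟨?_, ?_⟩
  · obtain ⟨u, v, huv, hadj, hu, hv⟩ := h.exists_ends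
    refine ⟨.inl u, .inl v, ?_, by simpa, (key u).2 hu, fun h => hv ((key v).1 h)⟩
    simpa using congrArg (Sym2.map (Sum.inl : _ → Option D.Node ⊕ Option D.Node)) huv
  · rintro (u | u) (v | v) huv hne
    · rw [key, key]
      refine h.mem_iff_of_adj u v (by simpa using huv) fun h' => hne ?_
      simpa using congrArg (Sym2.map (Sum.inl : _ → Option D.Node ⊕ Option D.Node)) h'
    · obtain ⟨rfl, rfl⟩ := segregationTree_adj_inl_inr.1 huv
      simp
    · obtain ⟨rfl, rfl⟩ := segregationTree_adj_inr_inl.1 huv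
      simp
    · simp

lemma isSide_inr {x y : Option D.Node} {S : Set D.Node}
    (h : IsSide (subdivide D.tree a) s(x, y) (some '' S)) :
    IsSide (D.segregationTree a b) s(.inr x, .inr y) (Sum.inr '' (some '' S)) := by
  have key : ∀ u : Option D.Node,
      (Sum.inr u : Option D.Node ⊕ Option D.Node) ∈ Sum.inr '' (some '' S) ↔ u ∈ some '' S :=
    fun u => Sum.inr_injective.mem_set_image
  refine ⟨?_, ?_⟩
  · obtain ⟨u, v, huv, hadj, hu, hv⟩ := h.exists_ends
    refine ⟨.inr u, .inr v, ?_, by simpa, (key u).2 hu, fun h => hv ((key v).1 h)⟩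
    simpa using congrArg (Sym2.map (Sum.inr : _ → Option D.Node ⊕ Option D.Node)) huv
  · rintro (u | u) (v | v) huv hne
    · simp
    · obtain ⟨rfl, rfl⟩ := segregationTree_adj_inl_inr.1 huv
      simp
    · obtain ⟨rfl, rfl⟩ := segregationTree_adj_inr_inl.1 huv
      simp
    · rw [key, key]
      refine h.mem_iff_of_adj u v (by simpa using huv) fun h' => hne ?_
      simpa using congrArg (Sym2.map (Sum.inr : _ → Option D.Node ⊕ Option D.Node)) h'

lemma isSide_middle :
    IsSide (D.segregationTree a b) s(.inl none, .inr none) (Set.range Sum.inl) := by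
  refine ⟨⟨_, _, rfl, by simp, by simp, by simp⟩, ?_⟩
  rintro (u | u) (v | v) huv hne
  · simp
  · obtain ⟨rfl, rfl⟩ := segregationTree_adj_inl_inr.1 huv
    exact absurd rfl hne
  · obtain ⟨rfl, rfl⟩ := segregationTree_adj_inr_inl.1 huv
    exact absurd Sym2.eq_swap hne
  · simp

lemma segregationTree_isTree (ha : a ∈ D.tree.edgeSet) (hb : b ∈ D.tree.edgeSet) :
    (D.segregationTree a b).IsTree := by
  have hT := D.isTree
  refine ⟨?_, isAcyclic_of_forall_exists_isSide ?_⟩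
  · exact (subdivide_connected hT.connected hb).sum_sup_edge (subdivide_connected hT.connected ha)
  · rintro (x | x) (y | y) hxy
    · obtain ⟨S, -, hS, -⟩ := IsSide.of_subdivide hT.isAcyclic hb
        (segregationTree_adj_inl_inl.1 hxy)
      exact ⟨_, isSide_inl hS⟩
    · obtain ⟨rfl, rfl⟩ := segregationTree_adj_inl_inr.1 hxy
      exact ⟨_, isSide_middle⟩
    · obtain ⟨rfl, rfl⟩ := segregationTree_adj_inr_inl.1 hxy
      exact ⟨_, by rw [Sym2.eq_swap]; exact isSide_middle⟩
    · obtain ⟨S, -, hS, -⟩ := IsSide.of_subdivide hT.isAcyclic ha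
        (segregationTree_adj_inr_inr.1 hxy)
      exact ⟨_, isSide_inr hS⟩

end SegregationTree

/-- The segregation along the links `a` and `b` and the partition of the vertex set into the
vertices in `W` and the vertices outside `W`. -/
@[reducible] def segregation (D : TreeCutDecomposition G) {a b : Sym2 D.Node} (ha : a ∈ D.tree.edgeSet)
    (hb : b ∈ D.tree.edgeSet) (W : Set α) : TreeCutDecomposition G where
  Node := Option D.Node ⊕ Option D.Node
  finite_node := by
    have := D.finite_node
    infer_instance
  tree := D.segregationTree a b
  isTree := segregationTree_isTree ha hb
  bag := D.segregationBag (V(G) ∩ W) (V(G) \ W)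
  disjoint_bag := by
    rintro ((_ | s) | (_ | s)) ((_ | t) | (_ | t)) hst <;>
      simp only [segregationBag, Set.disjoint_empty, Set.empty_disjoint]
    · exact (D.disjoint_bag s t fun h => hst (by rw [h])).mono Set.inter_subset_left
        Set.inter_subset_left
    · exact Set.disjoint_left.2 fun x hx hx' => hx'.2.2 hx.2.2
    · exact Set.disjoint_left.2 fun x hx hx' => hx.2.2 hx'.2.2
    · exact (D.disjoint_bag s t fun h => hst (by rw [h])).mono Set.inter_subset_left
        Set.inter_subset_left
  iUnion_bag := by
    ext x
    rw [Set.mem_iUnion]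
    constructor
    · rintro ⟨(_ | t) | (_ | t), hx⟩
      · exact absurd hx (Set.notMem_empty x)
      · exact hx.2.1
      · exact absurd hx (Set.notMem_empty x)
      · exact hx.2.1
    · intro hx
      obtain ⟨t, ht⟩ := D.exists_mem_bag hx
      by_cases hxW : x ∈ W
      · exact ⟨.inl (some t), ht, hx, hxW⟩
      · exact ⟨.inr (some t), ht, hx, hxW⟩

/-- The link of `D` from which a link of the segregation originates (with an arbitrary value for
the link that joins the two copies of the tree). -/
def originPair (D : TreeCutDecomposition G) (a b : Sym2 D.Node) :
    Option D.Node ⊕ Option D.Node → Option D.Node ⊕ Option D.Node → Sym2 D.Node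
  | .inl x, .inl y => subdivideProj b x y
  | .inr x, .inr y => subdivideProj a x y
  | _, _ => a

/-- The link of `D` from which a link of the segregation originates. -/
def origin (D : TreeCutDecomposition G) (a b : Sym2 D.Node) :
    Sym2 (Option D.Node ⊕ Option D.Node) → Sym2 D.Node :=
  Sym2.lift ⟨originPair D a b, by
    rintro (x | x) (y | y) <;> simp only [originPair] <;> exact subdivideProj_comm _ _ _⟩

/-! ### Copies of links and their adhesions -/

section Copies

variable {ha : a ∈ D.tree.edgeSet} {hb : b ∈ D.tree.edgeSet} {W : Set α}

/-- `e` is a link of the first copy of the tree, it originates from a link for which `S` is a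
side, and its adhesion is obtained by restricting this side to `W`. -/
structure IsLeftCopy (ha : a ∈ D.tree.edgeSet) (hb : b ∈ D.tree.edgeSet) (W : Set α)
    (e : Sym2 (Option D.Node ⊕ Option D.Node)) (S : Set D.Node) : Prop where
  exists_ends : ∃ x y, e = s(.inl x, .inl y) ∧ (subdivide D.tree b).Adj x y
  isSide : IsSide D.tree (D.origin a b e) S
  adhesion_eq : (D.segregation ha hb W).adhesion e = boundary G (D.bagUnion S ∩ W)
  forall_notMem : D.origin a b e ≠ b → ∀ t ∈ b, t ∉ S

/-- `e` is a link of the second copy of the tree, it originates from a link for which `S` is a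
side, and its adhesion is obtained by restricting this side to the complement of `W`. -/
structure IsRightCopy (ha : a ∈ D.tree.edgeSet) (hb : b ∈ D.tree.edgeSet) (W : Set α)
    (e : Sym2 (Option D.Node ⊕ Option D.Node)) (S : Set D.Node) : Prop where
  exists_ends : ∃ x y, e = s(.inr x, .inr y) ∧ (subdivide D.tree a).Adj x y
  isSide : IsSide D.tree (D.origin a b e) S
  adhesion_eq : (D.segregation ha hb W).adhesion e = boundary G (D.bagUnion S \ W)
  forall_notMem : D.origin a b e ≠ a → ∀ t ∈ a, t ∉ S

/-- The chosen side contains neither a subdivision node nor a node of the other copy, so its bags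
are those of `S` cut down to `W`. -/
lemma exists_isLeftCopy (ha : a ∈ D.tree.edgeSet) (hb : b ∈ D.tree.edgeSet) (W : Set α)
    {x y : Option D.Node} (hxy : (subdivide D.tree b).Adj x y) :
    ∃ S, IsLeftCopy ha hb W s(.inl x, .inl y) S := by
  obtain ⟨S, hS, hS', hSb⟩ := IsSide.of_subdivide D.isTree.isAcyclic hb hxy
  refine ⟨S, ⟨x, y, rfl, hxy⟩, hS, ?_, hSb⟩
  have h : IsSide (D.segregation ha hb W).tree s(.inl x, .inl y) (Sum.inl '' (some '' S)) :=
    isSide_inl hS'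
  refine (adhesion_eq_boundary h).trans (boundary_congr fun v hv => ?_)
  rw [mem_bagUnion, Set.mem_inter_iff, mem_bagUnion]
  constructor
  · rintro ⟨_, ⟨_, ⟨t, ht, rfl⟩, rfl⟩, hvt⟩
    exact ⟨⟨t, ht, hvt.1⟩, hvt.2.2⟩
  · rintro ⟨⟨t, ht, hvt⟩, hvW⟩
    exact ⟨_, ⟨_, ⟨t, ht, rfl⟩, rfl⟩, hvt, hv, hvW⟩

lemma exists_isRightCopy (ha : a ∈ D.tree.edgeSet) (hb : b ∈ D.tree.edgeSet) (W : Set α)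
    {x y : Option D.Node} (hxy : (subdivide D.tree a).Adj x y) :
    ∃ S, IsRightCopy ha hb W s(.inr x, .inr y) S := by
  obtain ⟨S, hS, hS', hSa⟩ := IsSide.of_subdivide D.isTree.isAcyclic ha hxy
  refine ⟨S, ⟨x, y, rfl, hxy⟩, hS, ?_, hSa⟩
  have h : IsSide (D.segregation ha hb W).tree s(.inr x, .inr y) (Sum.inr '' (some '' S)) :=
    isSide_inr hS'
  refine (adhesion_eq_boundary h).trans (boundary_congr fun v hv => ?_)
  rw [mem_bagUnion, Set.mem_sdiff, mem_bagUnion]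
  constructor
  · rintro ⟨_, ⟨_, ⟨t, ht, rfl⟩, rfl⟩, hvt⟩
    exact ⟨⟨t, ht, hvt.1⟩, hvt.2.2⟩
  · rintro ⟨⟨t, ht, hvt⟩, hvW⟩
    exact ⟨_, ⟨_, ⟨t, ht, rfl⟩, rfl⟩, hvt, hv, hvW⟩

lemma adhesion_middle (ha : a ∈ D.tree.edgeSet) (hb : b ∈ D.tree.edgeSet) (W : Set α) :
    (D.segregation ha hb W).adhesion s(.inl none, .inr none) = boundary G W := by
  have h : IsSide (D.segregation ha hb W).tree s(.inl none, .inr none) (Set.range Sum.inl) :=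
    isSide_middle
  refine (adhesion_eq_boundary h).trans (boundary_congr fun v hv => ?_)
  rw [mem_bagUnion]
  constructor
  · rintro ⟨_, ⟨_ | t, rfl⟩, hvt⟩
    · exact absurd hvt (Set.notMem_empty v)
    · exact hvt.2.2
  · intro hvW
    obtain ⟨t, ht⟩ := D.exists_mem_bag hv
    exact ⟨_, ⟨some t, rfl⟩, ht, hv, hvW⟩

lemma copy_cases (W : Set α) {e : Sym2 (Option D.Node ⊕ Option D.Node)}
    (he : e ∈ (D.segregationTree a b).edgeSet) :
    (∃ S, IsLeftCopy ha hb W e S) ∨ (∃ S, IsRightCopy ha hb W e S) ∨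
      e = s(.inl none, .inr none) := by
  induction e using Sym2.ind with
  | _ x y =>
    rw [SimpleGraph.mem_edgeSet] at he
    rcases x with x | x <;> rcases y with y | y
    · exact .inl (exists_isLeftCopy ha hb W (segregationTree_adj_inl_inl.1 he))
    · obtain ⟨rfl, rfl⟩ := segregationTree_adj_inl_inr.1 he
      exact .inr (.inr rfl)
    · obtain ⟨rfl, rfl⟩ := segregationTree_adj_inr_inl.1 he
      exact .inr (.inr Sym2.eq_swap)
    · exact .inr (.inl (exists_isRightCopy ha hb W (segregationTree_adj_inr_inr.1 he)))

lemma IsLeftCopy.origin_eq_of_ne {e e' : Sym2 (Option D.Node ⊕ Option D.Node)}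
    {S S' : Set D.Node} (h : IsLeftCopy ha hb W e S) (h' : IsLeftCopy ha hb W e' S') (hne : e ≠ e')
    (heq : D.origin a b e = D.origin a b e') : D.origin a b e = b := by
  by_contra hcon
  obtain ⟨x, y, rfl, hxy⟩ := h.exists_ends
  obtain ⟨x', y', rfl, hxy'⟩ := h'.exists_ends
  have := congrArg (Sym2.map (Sum.inl : _ → Option D.Node ⊕ Option D.Node))
    (eq_of_subdivideProj_eq hxy hxy' heq hcon)
  exact hne (by simpa using this)

lemma IsRightCopy.origin_eq_of_ne {e e' : Sym2 (Option D.Node ⊕ Option D.Node)}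
    {S S' : Set D.Node} (h : IsRightCopy ha hb W e S) (h' : IsRightCopy ha hb W e' S')
    (hne : e ≠ e') (heq : D.origin a b e = D.origin a b e') : D.origin a b e = a := by
  by_contra hcon
  obtain ⟨x, y, rfl, hxy⟩ := h.exists_ends
  obtain ⟨x', y', rfl, hxy'⟩ := h'.exists_ends
  have := congrArg (Sym2.map (Sum.inr : _ → Option D.Node ⊕ Option D.Node))
    (eq_of_subdivideProj_eq hxy hxy' heq hcon)
  exact hne (by simpa using this)

end Copies

/-- The data of a segregation that reduces the fatness: edge sets `A` and `B` of size `k` in the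
adhesions of `a` and `b`, a configuration `W` with less than `k` edges leaving it, which does not
cross the sides of links that contain neither `a` nor `b`, unless this is unavoidable. -/
structure IsReduction (D : TreeCutDecomposition G) (k μ : ℕ) (a b : Sym2 D.Node) (A B : Set β)
    (W : Set α) : Prop where
  finite : E(G).Finite
  left_mem : a ∈ D.tree.edgeSet
  right_mem : b ∈ D.tree.edgeSet
  left_subset : A ⊆ D.adhesion a
  right_subset : B ⊆ D.adhesion b
  left_card : A.ncard = k
  right_card : B.ncard = k
  lt : μ < k
  isConfig : IsConfig G A B μ W
  splitBound : SplitBound G A B μ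
  uncrossed : ∀ c S, IsSide D.tree c S → (∃ t ∈ a, t ∉ S) → (∃ t ∈ b, t ∉ S) →
    D.bagUnion S ⊆ W ∨ Disjoint (D.bagUnion S) W ∨
      (boundary G (D.bagUnion S ∩ W)).ncard < (boundary G (D.bagUnion S)).ncard ∧
      (boundary G (D.bagUnion S \ W)).ncard < (boundary G (D.bagUnion S)).ncard

namespace IsReduction

variable {k μ : ℕ} {A B : Set β} {W : Set α} (h : D.IsReduction k μ a b A B W)

/-- The segregation of a reduction. -/
abbrev result {k μ : ℕ} {A B : Set β} {W : Set α} (h : D.IsReduction k μ a b A B W) :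
    TreeCutDecomposition G :=
  D.segregation h.left_mem h.right_mem W

end IsReduction

lemma _root_.TreeCut.IsSide.exists_notMem {N : Type*} {T : SimpleGraph N} {c r : Sym2 N} {S : Set N}
    (h : IsSide T c S) (hS : c ≠ r → ∀ t ∈ r, t ∉ S) : ∃ t ∈ r, t ∉ S := by
  by_cases hc : c = r
  · obtain ⟨x, y, rfl, -, -, hy⟩ := h.exists_ends
    exact ⟨y, hc ▸ Sym2.mem_mk_right x y, hy⟩
  · induction r using Sym2.ind with
    | _ p q => exact ⟨p, Sym2.mem_mk_left p q, hS hc p (Sym2.mem_mk_left p q)⟩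

end TreeCutDecomposition

/-! ### Adhesions in the segregation compared with their originals -/

namespace TreeCutDecomposition

variable {G : Graph α β} {D : TreeCutDecomposition G} {a b : Sym2 D.Node}

namespace IsReduction

variable {k μ : ℕ} {A B : Set β} {W : Set α}
  {e e' : Sym2 (Option D.Node ⊕ Option D.Node)} {S S' : Set D.Node}

lemma middle_le (h : D.IsReduction k μ a b A B W) :
    (h.result.adhesion s(.inl none, .inr none)).ncard ≤ μ := by
  rw [adhesion_middle]
  exact h.isConfig.card_le

/-- The side `S` misses an end of `b`, so each edge of `B ⊆ adh(b)` has an end outside the bags of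
`S`, as `IsConfig.inter_le` requires. -/
lemma left_le (h : D.IsReduction k μ a b A B W) (he : IsLeftCopy h.left_mem h.right_mem W e S) :
    (h.result.adhesion e).ncard ≤ (D.adhesion (D.origin a b e)).ncard := by
  rw [he.adhesion_eq, adhesion_eq_boundary he.isSide]
  exact (h.isConfig.inter_le h.finite h.splitBound fun f hf =>
    exists_inc_notMem_bagUnion h.right_mem he.isSide
      (he.isSide.exists_notMem he.forall_notMem) (h.right_subset hf)).1

lemma right_le (h : D.IsReduction k μ a b A B W) (he : IsRightCopy h.left_mem h.right_mem W e S) :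
    (h.result.adhesion e).ncard ≤ (D.adhesion (D.origin a b e)).ncard := by
  rw [he.adhesion_eq, adhesion_eq_boundary he.isSide]
  exact (h.isConfig.diff_le h.finite h.splitBound fun f hf =>
    exists_inc_notMem_bagUnion h.left_mem he.isSide
      (he.isSide.exists_notMem he.forall_notMem) (h.left_subset hf)).1

lemma left_lt (h : D.IsReduction k μ a b A B W) (he : IsLeftCopy h.left_mem h.right_mem W e S)
    (hb : D.origin a b e = b) :
    (h.result.adhesion e).ncard < (D.adhesion (D.origin a b e)).ncard := by
  rw [he.adhesion_eq, adhesion_eq_boundary he.isSide]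
  refine h.isConfig.inter_lt h.finite h.splitBound ?_ (h.right_card ▸ h.lt)
  rw [← adhesion_eq_boundary he.isSide, hb]
  exact h.right_subset

lemma right_lt (h : D.IsReduction k μ a b A B W) (he : IsRightCopy h.left_mem h.right_mem W e S)
    (ha : D.origin a b e = a) :
    (h.result.adhesion e).ncard < (D.adhesion (D.origin a b e)).ncard := by
  rw [he.adhesion_eq, adhesion_eq_boundary he.isSide]
  refine h.isConfig.diff_lt h.finite h.splitBound ?_ (h.left_card ▸ h.lt)
  rw [← adhesion_eq_boundary he.isSide, ha]
  exact h.left_subset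

lemma adhesion_le (h : D.IsReduction k μ a b A B W) (he : e ∈ (D.segregationTree a b).edgeSet)
    (hk : k ≤ (h.result.adhesion e).ncard) : D.origin a b e ∈ D.tree.edgeSet ∧
      (h.result.adhesion e).ncard ≤ (D.adhesion (D.origin a b e)).ncard := by
  rcases copy_cases (ha := h.left_mem) (hb := h.right_mem) W he with
    ⟨S, hS⟩ | ⟨S, hS⟩ | rfl
  · exact ⟨hS.isSide.mem_edgeSet, h.left_le hS⟩
  · exact ⟨hS.isSide.mem_edgeSet, h.right_le hS⟩
  · exact absurd (hk.trans h.middle_le) (not_le.2 h.lt)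

/-- The sides chosen for the two copies are equal or complementary. If equal, the side misses an end
of `a` and an end of `b`, so it is uncrossed (one copy has empty adhesion) or both copies are
strictly smaller. If complementary, the two adhesions sum to at most `|∂C| + μ`. -/
lemma left_right_le (h : D.IsReduction k μ a b A B W)
    (he : IsLeftCopy h.left_mem h.right_mem W e S) (he' : IsRightCopy h.left_mem h.right_mem W e' S')
    (heq : D.origin a b e = D.origin a b e') :
    ((D.adhesion (D.origin a b e)).ncard ≤ (h.result.adhesion e).ncard →
      (h.result.adhesion e').ncard ≤ μ) ∧
    ((D.adhesion (D.origin a b e)).ncard ≤ (h.result.adhesion e').ncard →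
      (h.result.adhesion e).ncard ≤ μ) := by
  have hle := h.left_le he
  have hle' := h.right_le he'
  rw [← heq] at hle'
  rw [he.adhesion_eq] at hle ⊢
  rw [he'.adhesion_eq] at hle' ⊢
  rw [adhesion_eq_boundary he.isSide] at hle hle' ⊢
  have hS' := he'.isSide
  rw [← heq] at hS'
  have hempty : boundary G (∅ : Set α) = ∅ := by
    ext f
    simp [boundary]
  rcases he.isSide.eq_or_eq_compl D.isTree.connected hS' with rfl | rfl
  · rcases h.uncrossed _ S' hS' (he'.isSide.exists_notMem he'.forall_notMem)
      (he.isSide.exists_notMem he.forall_notMem) with h₁ | h₁ | h₁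
    · rw [Set.sdiff_eq_empty.2 h₁, hempty, Set.ncard_empty] at *
      omega
    · rw [Set.disjoint_iff_inter_eq_empty.1 h₁, hempty, Set.ncard_empty] at *
      omega
    · omega
  · have h₁ := boundary_inter_add_diff_le h.finite (D.bagUnion S) W
    have h₂ : boundary G (D.bagUnion Sᶜ \ W) = boundary G ((D.bagUnion S)ᶜ \ W) := by
      refine boundary_congr fun x hx => ?_
      rw [bagUnion_compl]
      simp [hx]
    rw [← h₂] at h₁
    have h₃ := h.isConfig.card_le
    omega

/-- Two copies of the same link cannot both have large adhesion if one of them has the same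
adhesion size as the original. -/
lemma lt_of_ne (h : D.IsReduction k μ a b A B W) (he : e ∈ (D.segregationTree a b).edgeSet)
    (he' : e' ∈ (D.segregationTree a b).edgeSet) (hne : e ≠ e')
    (heq : D.origin a b e = D.origin a b e') (hk : k ≤ (h.result.adhesion e).ncard)
    (hk' : k ≤ (h.result.adhesion e').ncard) :
    (h.result.adhesion e).ncard < (D.adhesion (D.origin a b e)).ncard := by
  have hlt := h.lt
  by_contra hcon
  rcases copy_cases (ha := h.left_mem) (hb := h.right_mem) W he with
    ⟨S, hS⟩ | ⟨S, hS⟩ | rfl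
  · rcases copy_cases (ha := h.left_mem) (hb := h.right_mem) W he' with
      ⟨S', hS'⟩ | ⟨S', hS'⟩ | rfl
    · exact hcon (h.left_lt hS (hS.origin_eq_of_ne hS' hne heq))
    · have := (h.left_right_le hS hS' heq).1 (not_lt.1 hcon)
      omega
    · have := h.middle_le
      omega
  · rcases copy_cases (ha := h.left_mem) (hb := h.right_mem) W he' with
      ⟨S', hS'⟩ | ⟨S', hS'⟩ | rfl
    · have := (h.left_right_le hS' hS heq.symm).2 (by rw [← heq]; exact not_lt.1 hcon)
      omega
    · exact hcon (h.right_lt hS (hS.origin_eq_of_ne hS' hne heq))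
    · have := h.middle_le
      omega
  · have := h.middle_le
    omega

/-- The projection of the nodes of the segregation to the nodes of `D`, with an arbitrary value
for the subdivision nodes. -/
def nodeProj (t₀ : D.Node) : Option D.Node ⊕ Option D.Node → D.Node :=
  Sum.elim (fun t => t.getD t₀) (fun t => t.getD t₀)

/-- Halves of a subdivided link are strictly smaller than their original, so a full-size copy is no
half and its ends project to the ends of its origin. -/
lemma origin_eq_map (h : D.IsReduction k μ a b A B W) (t₀ : D.Node)
    (he : e ∈ (D.segregationTree a b).edgeSet) (hk : k ≤ (h.result.adhesion e).ncard)
    (hfull : (D.adhesion (D.origin a b e)).ncard ≤ (h.result.adhesion e).ncard) :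
    D.origin a b e = Sym2.map (nodeProj t₀) e := by
  rcases copy_cases (ha := h.left_mem) (hb := h.right_mem) W he with
    ⟨S, hS⟩ | ⟨S, hS⟩ | rfl
  · have hb : D.origin a b e ≠ b := fun hb => absurd (h.left_lt hS hb) (not_lt.2 hfull)
    obtain ⟨x, y, rfl, -⟩ := hS.exists_ends
    cases x <;> cases y <;> first | exact absurd rfl hb | rfl
  · have ha : D.origin a b e ≠ a := fun ha => absurd (h.right_lt hS ha) (not_lt.2 hfull)
    obtain ⟨x, y, rfl, -⟩ := hS.exists_ends
    cases x <;> cases y <;> first | exact absurd rfl ha | rfl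
  · exact absurd (hk.trans h.middle_le) (not_le.2 h.lt)

end IsReduction

end TreeCutDecomposition

namespace TreeCutDecomposition

variable {G : Graph α β} {D D' : TreeCutDecomposition G}

/-! ### Comparing fatnesses -/

lemma mem_edgeSet_linkGraph {i : ℕ} {c : Sym2 D.Node} :
    c ∈ (D.linkGraph i).edgeSet ↔ c ∈ D.tree.edgeSet ∧ i ≤ (D.adhesion c).ncard := by
  rw [linkGraph, SimpleGraph.edgeSet_fromEdgeSet]
  refine ⟨fun h => h.1, fun h => ⟨h, fun hd => ?_⟩⟩
  exact D.tree.not_isDiag_of_mem_edgeSet h.1 hd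

lemma linkGraph_adj {i : ℕ} {s t : D.Node} :
    (D.linkGraph i).Adj s t ↔ D.tree.Adj s t ∧ i ≤ (D.adhesion s(s, t)).ncard := by
  rw [← SimpleGraph.mem_edgeSet, mem_edgeSet_linkGraph, SimpleGraph.mem_edgeSet]

lemma toLex_lt_toLex {n : ℕ} {f g : Fin n → ℤ} (i : Fin n) (hle : ∀ j < i, f j ≤ g j)
    (hlt : f i < g i) : toLex f < toLex g := by
  obtain ⟨j, hj, hmin⟩ := WellFounded.has_min (r := ((· < ·) : Fin n → Fin n → Prop))
    wellFounded_lt {j | f j < g j} ⟨i, hlt⟩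
  refine ⟨j, fun l hl => ?_, hj⟩
  have hji : j ≤ i := not_lt.1 (hmin i hlt)
  exact le_antisymm (hle l (hl.trans_le hji)) (not_lt.1 fun h => hmin l h hl)

/-- With `m = |E(G)|`, entry `2q` of the fatness is `α_{m-q}` and entry `2q+1` is `-β_{m-q}`; level
`i` thus sits at `2(m - i)`. Weak inequalities suffice above it, by `toLex_lt_toLex`. -/
lemma fatness_lt_of_levels (i : ℕ) (hi : 1 ≤ i) (him : i ≤ E(G).ncard)
    (hα : ∀ l, i < l → D'.alpha l ≤ D.alpha l) (hβ : ∀ l, i < l → D.beta l ≤ D'.beta l)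
    (h : D'.alpha i < D.alpha i ∨ D'.alpha i ≤ D.alpha i ∧ D.beta i < D'.beta i) :
    D'.fatness < D.fatness := by
  have hle : ∀ j : Fin (2 * E(G).ncard), E(G).ncard - i > j.val / 2 →
      ofLex D'.fatness j ≤ ofLex D.fatness j := by
    intro j hj
    have h₁ := hα (E(G).ncard - j.val / 2) (by omega)
    have h₂ := hβ (E(G).ncard - j.val / 2) (by omega)
    simp only [fatness, ofLex_toLex]
    split_ifs <;> omega
  rcases h with h | ⟨h, h'⟩
  · refine toLex_lt_toLex ⟨2 * (E(G).ncard - i), by omega⟩ (fun j hj => hle j ?_) ?_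
    · have : j.val < 2 * (E(G).ncard - i) := hj
      omega
    · have h₁ : (2 * (E(G).ncard - i)) % 2 = 0 := by omega
      have h₂ : E(G).ncard - 2 * (E(G).ncard - i) / 2 = i := by omega
      simp only [h₁, h₂, if_true]
      exact_mod_cast h
  · refine toLex_lt_toLex ⟨2 * (E(G).ncard - i) + 1, by omega⟩ (fun j hj => ?_) ?_
    · have hj' : j.val < 2 * (E(G).ncard - i) + 1 := hj
      by_cases hj'' : j.val < 2 * (E(G).ncard - i)
      · exact hle j (by omega)
      · have hjv : j.val = 2 * (E(G).ncard - i) := by omega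
        rw [if_pos (by omega), if_pos (by omega), show E(G).ncard - j.val / 2 = i by omega]
        exact_mod_cast h
    · have h₁ : (2 * (E(G).ncard - i) + 1) % 2 ≠ 0 := by omega
      have h₂ : E(G).ncard - (2 * (E(G).ncard - i) + 1) / 2 = i := by omega
      simp only [h₁, h₂, if_false]
      omega

/-- `D'` arises from `D` by copying links such that, for adhesions of size at least `k`, copies do
not have larger adhesions than the original, and two copies of the same link cannot both be large
if one of them has an adhesion of the original size. -/
structure IsThinning (D D' : TreeCutDecomposition G) (k : ℕ) (π : Sym2 D'.Node → Sym2 D.Node)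
    (ψ : D'.Node → D.Node) : Prop where
  adhesion_le : ∀ e ∈ D'.tree.edgeSet, k ≤ (D'.adhesion e).ncard →
    π e ∈ D.tree.edgeSet ∧ (D'.adhesion e).ncard ≤ (D.adhesion (π e)).ncard
  lt_of_ne : ∀ e ∈ D'.tree.edgeSet, ∀ e' ∈ D'.tree.edgeSet, e ≠ e' → π e = π e' →
    k ≤ (D'.adhesion e).ncard → k ≤ (D'.adhesion e').ncard →
    (D'.adhesion e).ncard < (D.adhesion (π e)).ncard
  eq_map : ∀ e ∈ D'.tree.edgeSet, k ≤ (D'.adhesion e).ncard →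
    (D.adhesion (π e)).ncard ≤ (D'.adhesion e).ncard → π e = Sym2.map ψ e

/-- All links of `D` with adhesion of size at least `i` have a copy with adhesion of the same
size. -/
def FullFrom (D D' : TreeCutDecomposition G) (π : Sym2 D'.Node → Sym2 D.Node) (i : ℕ) : Prop :=
  ∀ c ∈ D.tree.edgeSet, i ≤ (D.adhesion c).ncard →
    ∃ e ∈ D'.tree.edgeSet, π e = c ∧ (D.adhesion c).ncard ≤ (D'.adhesion e).ncard

namespace IsThinning

variable {k i : ℕ} {π : Sym2 D'.Node → Sym2 D.Node} {ψ : D'.Node → D.Node}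

lemma mapsTo (h : IsThinning D D' k π ψ) (hk : k ≤ i) :
    Set.MapsTo π (D'.linkGraph i).edgeSet (D.linkGraph i).edgeSet := by
  intro e he
  rw [mem_edgeSet_linkGraph] at he ⊢
  obtain ⟨h₁, h₂⟩ := h.adhesion_le e he.1 (hk.trans he.2)
  exact ⟨h₁, he.2.trans h₂⟩

/-- Two copies of size at least `i` of one link force its adhesion to exceed `i`, so by fullness
above `i` it has a full-size copy. That copy has another large copy beside it, which `lt_of_ne`
forbids. -/
lemma injOn (h : IsThinning D D' k π ψ) (hk : k ≤ i) (hfull : FullFrom D D' π (i + 1)) :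
    Set.InjOn π (D'.linkGraph i).edgeSet := by
  intro e he e' he' heq
  by_contra hne
  rw [mem_edgeSet_linkGraph] at he he'
  have hlt := h.lt_of_ne e he.1 e' he'.1 hne heq (hk.trans he.2) (hk.trans he'.2)
  have hc := (h.adhesion_le e he.1 (hk.trans he.2)).1
  obtain ⟨e₀, he₀, heq₀, hle⟩ := hfull (π e) hc (by omega)
  by_cases h₀ : e₀ = e
  · subst h₀
    omega
  · have := h.lt_of_ne e₀ he₀ e he.1 h₀ heq₀ (by omega) (by omega)
    rw [heq₀] at this
    omega

lemma alpha_le (h : IsThinning D D' k π ψ) (hk : k ≤ i) (hfull : FullFrom D D' π (i + 1)) :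
    D'.alpha i ≤ D.alpha i := by
  have := D.finite_node
  exact Set.ncard_le_ncard_of_injOn π (h.mapsTo hk) (h.injOn hk hfull) (Set.toFinite _)

/-- A link without a full-size copy at level `i` cannot lie above level `i`, so its adhesion is
exactly `i` and it has no copy of size at least `i`; the injection misses it. -/
lemma alpha_lt (h : IsThinning D D' k π ψ) (hk : k ≤ i) (hfull : FullFrom D D' π (i + 1))
    (hnot : ¬ FullFrom D D' π i) : D'.alpha i < D.alpha i := by
  have := D.finite_node
  have : ∃ c ∈ (D.linkGraph i).edgeSet, c ∉ π '' (D'.linkGraph i).edgeSet := by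
    simp only [FullFrom] at hnot
    push Not at hnot
    obtain ⟨c, hc, hi, hcopy⟩ := hnot
    refine ⟨c, mem_edgeSet_linkGraph.2 ⟨hc, hi⟩, ?_⟩
    rintro ⟨e, he, rfl⟩
    rw [mem_edgeSet_linkGraph] at he
    have h₁ := hcopy e he.1 rfl
    obtain ⟨e₀, he₀, heq, hle⟩ := hfull (π e) hc (by omega)
    exact absurd hle (not_le.2 (hcopy e₀ he₀ heq))
  obtain ⟨c, hc, hc'⟩ := this
  rw [alpha, ← (h.injOn hk hfull).ncard_image]
  exact Set.ncard_lt_ncard ((Set.ssubset_iff_of_subset (h.mapsTo hk).image_subset).2 ⟨c, hc, hc'⟩)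
    (Set.toFinite _)

/-- At a full level each surviving copy is the full-size copy of its origin, so `eq_map` makes `ψ` a
graph homomorphism, surjective because every link has a copy. Components therefore map onto
components. -/
lemma exists_hom (h : IsThinning D D' k π ψ) (hk : k ≤ i) (hfull : FullFrom D D' π i) :
    ∃ f : (D'.linkGraph i).induce (D'.linkGraph i).support →g
        (D.linkGraph i).induce (D.linkGraph i).support,
      (∀ t, (f t : D.Node) = ψ t) ∧ Function.Surjective f := by
  have hmap : ∀ e ∈ (D'.linkGraph i).edgeSet, π e = Sym2.map ψ e := by
    intro e he
    have he' := mem_edgeSet_linkGraph.1 he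
    refine h.eq_map e he'.1 (hk.trans he'.2) ?_
    have hc := (h.adhesion_le e he'.1 (hk.trans he'.2))
    obtain ⟨e₀, he₀, heq, hle⟩ := hfull (π e) hc.1 (he'.2.trans hc.2)
    have : e₀ = e := h.injOn hk (fun c hc hi => hfull c hc (by omega))
      (mem_edgeSet_linkGraph.2 ⟨he₀, by omega⟩) he heq
    rwa [this] at hle
  have hadj : ∀ u v, (D'.linkGraph i).Adj u v → (D.linkGraph i).Adj (ψ u) (ψ v) := by
    intro u v huv
    have huv' : s(u, v) ∈ (D'.linkGraph i).edgeSet := huv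
    have := h.mapsTo hk huv'
    rwa [hmap _ huv'] at this
  refine ⟨⟨fun t => ⟨ψ t, ?_⟩, fun {u v} huv => hadj u v huv⟩, fun _ => rfl, ?_⟩
  · obtain ⟨v, hv⟩ := t.2
    exact ⟨ψ v, hadj _ _ hv⟩
  · rintro ⟨t, t', htt'⟩
    have htt := linkGraph_adj.1 htt'
    obtain ⟨e, he, heq, hle⟩ := hfull s(t, t') htt.1 htt.2
    have he' : e ∈ (D'.linkGraph i).edgeSet := mem_edgeSet_linkGraph.2 ⟨he, htt.2.trans hle⟩
    rw [hmap e he'] at heq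
    induction e using Sym2.ind with
    | _ u v =>
      rw [SimpleGraph.mem_edgeSet] at he'
      rcases Sym2.eq_iff.1 heq with ⟨hu, hv⟩ | ⟨hu, hv⟩
      · exact ⟨⟨u, v, he'⟩, Subtype.ext hu⟩
      · exact ⟨⟨v, u, he'.symm⟩, Subtype.ext hv⟩

lemma beta_le (h : IsThinning D D' k π ψ) (hk : k ≤ i) (hfull : FullFrom D D' π i) :
    D.beta i ≤ D'.beta i := by
  have := D'.finite_node
  obtain ⟨f, -, hf⟩ := h.exists_hom hk hfull
  refine Nat.card_le_card_of_surjective (SimpleGraph.ConnectedComponent.map f) ?_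
  rintro ⟨t⟩
  obtain ⟨s, rfl⟩ := hf t
  exact ⟨SimpleGraph.connectedComponentMk _ s, rfl⟩

lemma beta_lt (h : IsThinning D D' k π ψ) (hk : k ≤ i) (hfull : FullFrom D D' π i)
    {u v : D'.Node} (hu : u ∈ (D'.linkGraph i).support) (hv : v ∈ (D'.linkGraph i).support)
    (huv : (D.linkGraph i).Reachable (ψ u) (ψ v)) (huv' : ¬ (D'.linkGraph i).Reachable u v) :
    D.beta i < D'.beta i := by
  have := D'.finite_node
  have := D.finite_node
  obtain ⟨f, hfψ, hf⟩ := h.exists_hom hk hfull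
  have hsurj : Function.Surjective (SimpleGraph.ConnectedComponent.map f) := by
    rintro ⟨t⟩
    obtain ⟨s, rfl⟩ := hf t
    exact ⟨SimpleGraph.connectedComponentMk _ s, rfl⟩
  have hreach : ∀ s t, (D.linkGraph i).Reachable s t → ∀ (hs : s ∈ (D.linkGraph i).support)
      (ht : t ∈ (D.linkGraph i).support),
      ((D.linkGraph i).induce (D.linkGraph i).support).Reachable ⟨s, hs⟩ ⟨t, ht⟩ := by
    rintro s t ⟨p⟩
    induction p with
    | nil => exact fun _ _ => .refl _
    | @cons s w t hadj _ ih =>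
      intro hs ht
      have hw : w ∈ (D.linkGraph i).support := ⟨s, hadj.symm⟩
      have hadj' : ((D.linkGraph i).induce (D.linkGraph i).support).Adj ⟨s, hs⟩ ⟨w, hw⟩ := hadj
      exact hadj'.reachable.trans (ih hw ht)
  have hninj : ¬ Function.Injective (SimpleGraph.ConnectedComponent.map f) := by
    intro hinj
    have : ((D'.linkGraph i).induce (D'.linkGraph i).support).connectedComponentMk ⟨u, hu⟩ =
        ((D'.linkGraph i).induce (D'.linkGraph i).support).connectedComponentMk ⟨v, hv⟩ := by
      apply hinj
      rw [SimpleGraph.ConnectedComponent.map_mk, SimpleGraph.ConnectedComponent.map_mk,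
        SimpleGraph.ConnectedComponent.eq]
      have huv₁ : (D.linkGraph i).Reachable (f ⟨u, hu⟩ : D.Node) (f ⟨v, hv⟩ : D.Node) := by
        rw [hfψ, hfψ]
        exact huv
      exact hreach _ _ huv₁ _ _
    rw [SimpleGraph.ConnectedComponent.eq] at this
    exact huv' (this.map (SimpleGraph.Embedding.induce _).toHom)
  refine lt_of_le_of_ne (Nat.card_le_card_of_surjective _ hsurj) fun hcard => hninj ?_
  exact ((Nat.bijective_iff_surjective_and_card _).2 ⟨hsurj, hcard.symm⟩).1

/-- A thinning reduces the fatness if it disconnects links of adhesion at least `k`. -/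
theorem fatness_lt (h : IsThinning D D' k π ψ) (hE : E(G).Finite) (hk : 1 ≤ k)
    (hkm : k ≤ E(G).ncard)
    (hβ : FullFrom D D' π k → D.beta k < D'.beta k) : D'.fatness < D.fatness := by
  classical
  have hbound : FullFrom D D' π (E(G).ncard + 1) := fun c _ hi => by
    have := Set.ncard_le_ncard (adhesion_subset (c := c)) hE
    omega
  by_cases hfull : FullFrom D D' π k
  · refine fatness_lt_of_levels k hk hkm (fun l hl => h.alpha_le hl.le ?_)
      (fun l hl => h.beta_le hl.le ?_) (.inr ⟨h.alpha_le le_rfl ?_, hβ hfull⟩)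
    all_goals exact fun c hc hi => hfull c hc (by omega)
  -- Levels above `|E(G)|` are vacuously full. The least such `n` singles out `k + n` as the highest
  -- level that is not full, and there `α` drops.
  · have hex : ∃ n, FullFrom D D' π (k + n + 1) := ⟨E(G).ncard - k, by
      rw [Nat.add_sub_cancel' hkm]; exact hbound⟩
    have hmin : ¬ FullFrom D D' π (k + Nat.find hex) := by
      rcases Nat.eq_zero_or_pos (Nat.find hex) with h₀ | h₀
      · rwa [h₀]
      · have := Nat.find_min hex (Nat.sub_lt h₀ Nat.one_pos)
        rwa [show k + (Nat.find hex - 1) + 1 = k + Nat.find hex by omega] at this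
    have hfull' := Nat.find_spec hex
    have hle : k + Nat.find hex ≤ E(G).ncard := by
      by_contra hcon
      exact hmin fun c hc hi => hbound c hc (by omega)
    refine fatness_lt_of_levels (k + Nat.find hex) (by omega) hle
      (fun l hl => h.alpha_le (by omega) ?_) (fun l hl => h.beta_le (by omega) ?_)
      (.inl (h.alpha_lt (by omega) hfull' hmin))
    all_goals exact fun c hc hi => hfull' c hc (by omega)

end IsThinning

end TreeCutDecomposition

/-! ### The path between two links and the drop in fatness -/

lemma IsSide.mem_edges_of_walk {N : Type*} {T : SimpleGraph N} {c : Sym2 N} {S : Set N}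
    (h : IsSide T c S) {x y : N} (p : T.Walk x y) (hx : x ∉ S) (hy : y ∈ S) : c ∈ p.edges := by
  by_contra hc
  have key : ∀ {x y : N} (p : T.Walk x y), c ∉ p.edges → (x ∈ S ↔ y ∈ S) := by
    intro x y p
    induction p with
    | nil => exact fun _ => Iff.rfl
    | cons hadj p ih =>
      intro hc
      rw [SimpleGraph.Walk.edges_cons, List.mem_cons, not_or] at hc
      exact (h.mem_iff_of_adj _ _ hadj (Ne.symm hc.1)).trans (ih hc.2)
  exact hx ((key p hc).2 hy)

lemma IsSide.head?_edges {N : Type*} {T : SimpleGraph N} {x z y : N} {S : Set N}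
    (h : IsSide T s(x, z) S) (p : T.Walk x y) (hp : p.IsPath) (hx : x ∉ S) (hy : y ∈ S) :
    p.edges.head? = some s(x, z) := by
  cases p with
  | nil => exact absurd hy hx
  | @cons _ w _ hadj q =>
    rw [SimpleGraph.Walk.edges_cons, List.head?_cons]
    by_contra hne
    have hne' : s(x, w) ≠ s(x, z) := fun h => hne (by rw [h])
    have hw : w ∉ S := fun hw => hx ((h.mem_iff_of_adj _ _ hadj hne').2 hw)
    have := q.fst_mem_support_of_mem_edges (h.mem_edges_of_walk q hw hy)
    exact ((SimpleGraph.Walk.cons_isPath_iff _ _).1 hp).2 this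

/-- The node `x` is the end of `a` farther from `b`. A path from it to the far end of `b` starts
with `a` and ends with `b`, as `linkPath` demands. -/
lemma exists_isSide_forall_mem {N : Type*} {T : SimpleGraph N} (hT : T.IsAcyclic) {a b : Sym2 N}
    (ha : a ∈ T.edgeSet) (hb : b ∈ T.edgeSet) (hab : a ≠ b) :
    ∃ x z S, a = s(x, z) ∧ IsSide T s(x, z) S ∧ x ∉ S ∧ ∀ t ∈ b, t ∈ S := by
  induction a using Sym2.ind with
  | _ x z =>
    obtain ⟨S, hS, hx, hz⟩ := exists_isSide hT (T.mem_edgeSet.1 ha)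
    by_cases hout : ∃ t ∈ b, t ∉ S
    · exact ⟨x, z, Sᶜ, rfl, hS.compl, by simpa, hS.forall_notMem hb hab.symm hout⟩
    · push Not at hout
      exact ⟨z, x, S, Sym2.eq_swap, by rwa [Sym2.eq_swap], hz, hout⟩

namespace TreeCutDecomposition

variable {G : Graph α β} {D : TreeCutDecomposition G} {a b : Sym2 D.Node}

lemma reachable_linkGraph {k : ℕ} (ha : a ∈ D.tree.edgeSet) (hb : b ∈ D.tree.edgeSet)
    (hab : a ≠ b) (hk : ∀ c ∈ linkPath D.tree a b, k ≤ (D.adhesion c).ncard) {s t : D.Node}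
    (hs : s ∈ a) (ht : t ∈ b) : (D.linkGraph k).Reachable s t := by
  obtain ⟨x, x', S, hax, hS, hxS, hbS⟩ :=
    exists_isSide_forall_mem D.isTree.isAcyclic ha hb hab
  obtain ⟨y, y', S', hby, hS', hyS', haS'⟩ :=
    exists_isSide_forall_mem D.isTree.isAcyclic hb ha hab.symm
  obtain ⟨p, hp⟩ := (D.isTree.connected.preconnected x y).exists_isPath
  have hhead : p.edges.head? = some a := by
    rw [hax]
    exact hS.head?_edges p hp hxS (hbS y (hby ▸ Sym2.mem_mk_left y y'))
  have hlast : p.edges.getLast? = some b := by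
    have := hS'.head?_edges p.reverse hp.reverse hyS' (haS' x (hax ▸ Sym2.mem_mk_left x x'))
    rwa [SimpleGraph.Walk.edges_reverse, List.head?_reverse, ← hby] at this
  have hedges : ∀ c ∈ p.edges, c ∈ (D.linkGraph k).edgeSet := fun c hc =>
    mem_edgeSet_linkGraph.2 ⟨p.edges_subset_edgeSet hc, hk c ⟨x, y, p, hp, hhead, hlast, hc⟩⟩
  have hxy : (D.linkGraph k).Reachable x y := (p.transfer _ hedges).reachable
  have hxx : (D.linkGraph k).Adj x x' := by
    rw [← SimpleGraph.mem_edgeSet, ← hax]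
    exact hedges a (List.mem_of_head? hhead)
  have hyy : (D.linkGraph k).Adj y y' := by
    rw [← SimpleGraph.mem_edgeSet, ← hby]
    exact hedges b (List.mem_of_getLast? hlast)
  have h₁ : (D.linkGraph k).Reachable s x := by
    rw [hax] at hs
    rcases Sym2.mem_iff.1 hs with rfl | rfl
    · exact .refl _
    · exact hxx.symm.reachable
  have h₂ : (D.linkGraph k).Reachable y t := by
    rw [hby] at ht
    rcases Sym2.mem_iff.1 ht with rfl | rfl
    · exact .refl _
    · exact hyy.reachable
  exact h₁.trans (hxy.trans h₂)

namespace IsReduction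

variable {k μ : ℕ} {A B : Set β} {W : Set α}

lemma isThinning (h : D.IsReduction k μ a b A B W) (t₀ : D.Node) :
    IsThinning D h.result k (D.origin a b) (nodeProj t₀) where
  adhesion_le _ he hk := h.adhesion_le he hk
  lt_of_ne _ he _ he' hne heq hk hk' := h.lt_of_ne he he' hne heq hk hk'
  eq_map _ he hk hfull := h.origin_eq_map t₀ he hk hfull

lemma le_adhesion_left (h : D.IsReduction k μ a b A B W) : k ≤ (D.adhesion a).ncard := by
  rw [← h.left_card]
  exact Set.ncard_le_ncard h.left_subset (h.finite.subset adhesion_subset)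

lemma le_adhesion_right (h : D.IsReduction k μ a b A B W) : k ≤ (D.adhesion b).ncard := by
  rw [← h.right_card]
  exact Set.ncard_le_ncard h.right_subset (h.finite.subset adhesion_subset)

/-- In `D` the links of `aTb` connect `a` and `b` at level `k`. Halves being strictly smaller, the
full copy of `a` lies in the first tree and that of `b` in the second, while the link joining the
trees has adhesion below `k`. -/
lemma beta_lt (h : D.IsReduction k μ a b A B W)
    (hk : ∀ c ∈ linkPath D.tree a b, k ≤ (D.adhesion c).ncard)
    (hfull : FullFrom D h.result (D.origin a b) k) : D.beta k < h.result.beta k := by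
  obtain ⟨t₀⟩ := D.isTree.connected.nonempty
  have hth := h.isThinning t₀
  have hmid : ∀ x y : Option D.Node, ¬ (h.result.linkGraph k).Adj (.inl x) (.inr y) := by
    intro x y hxy
    rw [linkGraph_adj] at hxy
    obtain ⟨rfl, rfl⟩ := segregationTree_adj_inl_inr.1 hxy.1
    exact absurd (hxy.2.trans h.middle_le) (not_le.2 h.lt)
  obtain ⟨e, he, hea, hle⟩ := hfull a h.left_mem h.le_adhesion_left
  obtain ⟨f, hf, hfb, hlf⟩ := hfull b h.right_mem h.le_adhesion_right
  have hke := h.le_adhesion_left.trans hle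
  have hkf := h.le_adhesion_right.trans hlf
  have hemap := h.origin_eq_map t₀ he hke (by rwa [hea])
  have hfmap := h.origin_eq_map t₀ hf hkf (by rwa [hfb])
  obtain ⟨S, hS⟩ : ∃ S, IsLeftCopy h.left_mem h.right_mem W e S := by
    rcases copy_cases (ha := h.left_mem) (hb := h.right_mem) W he with hS | ⟨S, hS⟩ | rfl
    · exact hS
    · have := h.right_lt hS hea
      rw [hea] at this
      omega
    · exact absurd (hke.trans h.middle_le) (not_le.2 h.lt)
  obtain ⟨S', hS'⟩ : ∃ S, IsRightCopy h.left_mem h.right_mem W f S := by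
    rcases copy_cases (ha := h.left_mem) (hb := h.right_mem) W hf with ⟨S, hS⟩ | hS | rfl
    · have := h.left_lt hS hfb
      rw [hfb] at this
      omega
    · exact hS
    · exact absurd (hkf.trans h.middle_le) (not_le.2 h.lt)
  -- If `a = b`, the full copy of `a` in the first tree would be a half of the subdivided link `b`,
  -- hence strictly smaller.
  have hab : a ≠ b := by
    intro hab
    have := h.left_lt hS (hea.trans hab)
    rw [hea] at this
    omega
  obtain ⟨x, y, rfl, -⟩ := hS.exists_ends
  obtain ⟨x', y', rfl, -⟩ := hS'.exists_ends
  have hxy : (h.result.linkGraph k).Adj (.inl x) (.inl y) := linkGraph_adj.2 ⟨he, hke⟩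
  have hxy' : (h.result.linkGraph k).Adj (.inr x') (.inr y') := linkGraph_adj.2 ⟨hf, hkf⟩
  refine hth.beta_lt (u := .inl x) (v := .inr x') le_rfl hfull ⟨_, hxy⟩ ⟨_, hxy'⟩ ?_ ?_
  · refine reachable_linkGraph h.left_mem h.right_mem hab hk ?_ ?_
    · rw [← hea, hemap]
      exact Sym2.mem_mk_left _ _
    · rw [← hfb, hfmap]
      exact Sym2.mem_mk_left _ _
  · have key : ∀ u v : Option D.Node ⊕ Option D.Node, (h.result.linkGraph k).Reachable u v →
        (u.isLeft ↔ v.isLeft) := by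
      rintro u v ⟨p⟩
      induction p with
      | nil => rfl
      | @cons u w v hadj _ ih =>
        refine Iff.trans ?_ ih
        rcases u with u | u <;> rcases w with w | w
        · simp
        · exact absurd hadj (hmid u w)
        · exact absurd hadj.symm (hmid w u)
        · simp
    intro hr
    simpa using key _ _ hr

theorem fatness_lt (h : D.IsReduction k μ a b A B W)
    (hk : ∀ c ∈ linkPath D.tree a b, k ≤ (D.adhesion c).ncard) :
    h.result.fatness < D.fatness := by
  obtain ⟨t₀⟩ := D.isTree.connected.nonempty
  refine (h.isThinning t₀).fatness_lt h.finite ?_ ?_ (h.beta_lt hk)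
  · exact (Nat.zero_le μ).trans_lt h.lt
  · exact h.le_adhesion_left.trans (Set.ncard_le_ncard adhesion_subset h.finite)

end IsReduction

/-! ### Width -/

lemma adhesion_le_width {c : Sym2 D.Node} (hc : c ∈ D.tree.edgeSet) :
    (D.adhesion c).ncard ≤ D.width := by
  have := D.finite_node
  exact (le_ciSup (f := fun l : D.tree.edgeSet => (D.adhesion l).ncard)
    (Set.finite_range _).bddAbove ⟨c, hc⟩).trans (le_max_left _ _)

lemma ncard_bag_add_le_width (t : D.Node) : (D.bag t).ncard +
    {t' : D.Node | D.tree.Adj t t' ∧ 2 < (D.adhesion s(t, t')).ncard}.ncard ≤ D.width := by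
  have := D.finite_node
  exact (le_ciSup (f := fun t : D.Node => (D.bag t).ncard +
    {t' : D.Node | D.tree.Adj t t' ∧ 2 < (D.adhesion s(t, t')).ncard}.ncard)
    (Set.finite_range _).bddAbove t).trans (le_max_right _ _)

lemma width_le {w : ℕ} (hl : ∀ c ∈ D.tree.edgeSet, (D.adhesion c).ncard ≤ w)
    (ht : ∀ t, (D.bag t).ncard +
      {t' : D.Node | D.tree.Adj t t' ∧ 2 < (D.adhesion s(t, t')).ncard}.ncard ≤ w) :
    D.width ≤ w :=
  max_le (ciSup_le' fun c => hl c c.2) (ciSup_le' ht)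

lemma ncard_links_le (t : D.Node) :
    {c | c ∈ D.tree.edgeSet ∧ t ∈ c ∧ 2 < (D.adhesion c).ncard}.ncard ≤
      {t' : D.Node | D.tree.Adj t t' ∧ 2 < (D.adhesion s(t, t')).ncard}.ncard := by
  have := D.finite_node
  have : {c | c ∈ D.tree.edgeSet ∧ t ∈ c ∧ 2 < (D.adhesion c).ncard} =
      (fun t' => s(t, t')) ''
        {t' : D.Node | D.tree.Adj t t' ∧ 2 < (D.adhesion s(t, t')).ncard} := by
    ext c
    constructor
    · rintro ⟨hc, htc, hlt⟩
      obtain ⟨t', rfl⟩ := Sym2.mem_iff_exists.1 htc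
      exact ⟨t', ⟨hc, hlt⟩, rfl⟩
    · rintro ⟨t', ⟨hadj, hlt⟩, rfl⟩
      exact ⟨hadj, Sym2.mem_mk_left _ _, hlt⟩
  rw [this]
  exact Set.ncard_image_le (Set.toFinite _)

lemma mem_subdivideProj_some {N : Type*} {T : SimpleGraph N} {r : Sym2 N} {t : N} {x : Option N}
    (h : (subdivide T r).Adj (some t) x) : t ∈ subdivideProj r (some t) x := by
  cases x with
  | none => exact subdivide_adj_some_none.1 h
  | some s => exact Sym2.mem_mk_left _ _

lemma subdivideProj_some_injective {N : Type*} {T : SimpleGraph N} {r : Sym2 N} {t : N}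
    {x y : Option N} (hx : (subdivide T r).Adj (some t) x) (hy : (subdivide T r).Adj (some t) y)
    (h : subdivideProj r (some t) x = subdivideProj r (some t) y) : x = y := by
  cases x <;> cases y <;> simp_all [subdivideProj]
  rcases h with h | ⟨h₁, h₂⟩
  · exact h
  · exact h₂.trans h₁

namespace IsReduction

variable {k μ : ℕ} {A B : Set β} {W : Set α}

lemma adhesion_le_width (h : D.IsReduction k μ a b A B W)
    {e : Sym2 (Option D.Node ⊕ Option D.Node)} (he : e ∈ (D.segregationTree a b).edgeSet) :
    (h.result.adhesion e).ncard ≤ D.width := by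
  rcases copy_cases (ha := h.left_mem) (hb := h.right_mem) W he with ⟨S, hS⟩ | ⟨S, hS⟩ | rfl
  · exact (h.left_le hS).trans (TreeCutDecomposition.adhesion_le_width hS.isSide.mem_edgeSet)
  · exact (h.right_le hS).trans (TreeCutDecomposition.adhesion_le_width hS.isSide.mem_edgeSet)
  · exact (h.middle_le.trans h.lt.le).trans
      (h.le_adhesion_left.trans (TreeCutDecomposition.adhesion_le_width h.left_mem))

/-- For the subdivision nodes, which have three neighbours and an empty bag: as soon as one counted
link exists, its adhesion exceeds two and the width is already at least three. -/
lemma ncard_neighbors_none_le (h : D.IsReduction k μ a b A B W)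
    (s : Option D.Node ⊕ Option D.Node) (P : Set (Option D.Node ⊕ Option D.Node))
    (hP : P.ncard ≤ 3) (hsP : ∀ t, (D.segregationTree a b).Adj s t → t ∈ P) :
    {t' | (D.segregationTree a b).Adj s t' ∧ 2 < (h.result.adhesion s(s, t')).ncard}.ncard ≤
      D.width := by
  have := D.finite_node
  rcases Set.eq_empty_or_nonempty
    {t' | (D.segregationTree a b).Adj s t' ∧ 2 < (h.result.adhesion s(s, t')).ncard} with
    h₀ | ⟨t, ht, hlt⟩
  · rw [h₀, Set.ncard_empty]
    exact Nat.zero_le _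
  · have h₁ : 2 < D.width :=
      hlt.trans_le (h.adhesion_le_width ((SimpleGraph.mem_edgeSet _).2 ht))
    refine (Set.ncard_le_ncard (fun t' ht' => hsP t' ht'.1) (Set.toFinite _)).trans ?_
    omega

/-- Distinct links at the copy of `t` originate from distinct links at `t`, whose adhesions are at
least as large. -/
lemma neighbors_inl_le (h : D.IsReduction k μ a b A B W) (t : D.Node) :
    {t' | (D.segregationTree a b).Adj (.inl (some t)) t' ∧
      2 < (h.result.adhesion s(.inl (some t), t')).ncard}.ncard ≤
    {t' : D.Node | D.tree.Adj t t' ∧ 2 < (D.adhesion s(t, t')).ncard}.ncard := by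
  have := D.finite_node
  refine (Set.ncard_le_ncard_of_injOn (fun x => D.origin a b s(.inl (some t), x)) ?_ ?_
    (Set.toFinite _)).trans (ncard_links_le t)
  · rintro (x | x) ⟨hx, hlt⟩
    · have hx' := segregationTree_adj_inl_inl.1 hx
      obtain ⟨S, hS⟩ := exists_isLeftCopy h.left_mem h.right_mem W hx'
      exact ⟨hS.isSide.mem_edgeSet, mem_subdivideProj_some hx', hlt.trans_le (h.left_le hS)⟩
    · simp at hx
  · rintro (x | x) ⟨hx, -⟩ (y | y) ⟨hy, -⟩ heq
    · rw [subdivideProj_some_injective (segregationTree_adj_inl_inl.1 hx)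
        (segregationTree_adj_inl_inl.1 hy) heq]
    all_goals simp at hx hy

lemma neighbors_inr_le (h : D.IsReduction k μ a b A B W) (t : D.Node) :
    {t' | (D.segregationTree a b).Adj (.inr (some t)) t' ∧
      2 < (h.result.adhesion s(.inr (some t), t')).ncard}.ncard ≤
    {t' : D.Node | D.tree.Adj t t' ∧ 2 < (D.adhesion s(t, t')).ncard}.ncard := by
  have := D.finite_node
  refine (Set.ncard_le_ncard_of_injOn (fun x => D.origin a b s(.inr (some t), x)) ?_ ?_
    (Set.toFinite _)).trans (ncard_links_le t)
  · rintro (x | x) ⟨hx, hlt⟩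
    · simp at hx
    · have hx' := segregationTree_adj_inr_inr.1 hx
      obtain ⟨S, hS⟩ := exists_isRightCopy h.left_mem h.right_mem W hx'
      exact ⟨hS.isSide.mem_edgeSet, mem_subdivideProj_some hx', hlt.trans_le (h.right_le hS)⟩
  · rintro (x | x) ⟨hx, -⟩ (y | y) ⟨hy, -⟩ heq
    on_goal 4 => rw [subdivideProj_some_injective (segregationTree_adj_inr_inr.1 hx)
        (segregationTree_adj_inr_inr.1 hy) heq]
    all_goals simp at hx hy

theorem width_le (h : D.IsReduction k μ a b A B W) (hV : V(G).Finite) :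
    h.result.width ≤ D.width := by
  refine TreeCutDecomposition.width_le (fun e he => h.adhesion_le_width he) ?_
  have hbag : ∀ t (X : Set α), (D.bag t ∩ X).ncard ≤ (D.bag t).ncard := fun t X =>
    Set.ncard_le_ncard Set.inter_subset_left (hV.subset (bag_subset t))
  have hthree : ∀ x y z : Option D.Node ⊕ Option D.Node, ({x, y, z} : Set _).ncard ≤ 3 := by
    intro x y z
    have h₁ := Set.ncard_insert_le x {y, z}
    have h₂ := Set.ncard_insert_le y {z}
    rw [Set.ncard_singleton] at h₂
    omega
  have hempty : (∅ : Set α).ncard = 0 := Set.ncard_empty α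
  rintro ((_ | t) | (_ | t))
  · obtain ⟨p, q, hpq⟩ : ∃ p q, b = s(p, q) := ⟨_, _, (Quot.out_eq b).symm⟩
    refine (Nat.add_le_add hempty.le (h.ncard_neighbors_none_le (.inl none)
      {.inl (some p), .inl (some q), .inr none} (hthree _ _ _) ?_)).trans (by omega)
    rintro ((_ | t) | (_ | t)) ht
    · simp at ht
    · have := subdivide_adj_none_some.1 (segregationTree_adj_inl_inl.1 ht)
      rw [hpq] at this
      simpa using this
    · simp
    · simp at ht
  · exact (Nat.add_le_add (hbag t _) (h.neighbors_inl_le t)).trans (ncard_bag_add_le_width t)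
  · obtain ⟨p, q, hpq⟩ : ∃ p q, a = s(p, q) := ⟨_, _, (Quot.out_eq a).symm⟩
    refine (Nat.add_le_add hempty.le (h.ncard_neighbors_none_le (.inr none)
      {.inr (some p), .inr (some q), .inl none} (hthree _ _ _) ?_)).trans (by omega)
    rintro ((_ | t) | (_ | t)) ht
    · simp
    · simp at ht
    · simp at ht
    · have := subdivide_adj_none_some.1 (segregationTree_adj_inr_inr.1 ht)
      rw [hpq] at this
      simpa using this
  · exact (Nat.add_le_add (hbag t _) (h.neighbors_inr_le t)).trans (ncard_bag_add_le_width t)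

end IsReduction

end TreeCutDecomposition

namespace TreeCutDecomposition

variable {G : Graph α β} {D : TreeCutDecomposition G} {a b : Sym2 D.Node}

/-! ### Well-foundedness of fatness -/

/-- Each component has a link at its representative node, and a link belongs to only one component.
-/
lemma beta_le_alpha (D : TreeCutDecomposition G) (i : ℕ) : D.beta i ≤ D.alpha i := by
  classical
  have := D.finite_node
  have hex : ∀ t : (D.linkGraph i).support, ∃ e : (D.linkGraph i).edgeSet, (t : D.Node) ∈ e.1 := by
    rintro ⟨t, t', htt'⟩
    exact ⟨⟨s(t, t'), htt'⟩, Sym2.mem_mk_left _ _⟩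
  choose e he using hex
  refine Nat.card_le_card_of_injective
    (fun c : ((D.linkGraph i).induce (D.linkGraph i).support).ConnectedComponent => e c.out) ?_
  intro c c' hcc
  rw [← c.out_eq, ← c'.out_eq]
  have h₁ := he c.out
  have h₂ := he c'.out
  have hcc' : e c.out = e c'.out := hcc
  rw [hcc'] at h₁
  by_cases heq : c.out = c'.out
  · rw [heq]
  · apply SimpleGraph.ConnectedComponent.sound
    have hadj : (D.linkGraph i).Adj c.out c'.out := by
      rw [← SimpleGraph.mem_edgeSet,
        ← (Sym2.mem_and_mem_iff fun h => heq (Subtype.ext h)).1 ⟨h₁, h₂⟩]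
      exact (e c'.out).2
    exact SimpleGraph.Adj.reachable (show ((D.linkGraph i).induce _).Adj _ _ from hadj)

/-- Replacing `-β` by `α - β`, natural by `beta_le_alpha`, keeps strict decreases: `α_i` immediately
precedes `-β_i` and must tie before `-β_i` is compared. Lexicographic tuples of naturals of fixed
length are well-founded. -/
theorem wellFounded_fatness (G : Graph α β) :
    WellFounded fun D' D : TreeCutDecomposition G => D'.fatness < D.fatness := by
  let f : TreeCutDecomposition G → Lex (Fin (2 * E(G).ncard) → ℕ) := fun D => toLex fun j =>
    if j.val % 2 = 0 then D.alpha (E(G).ncard - j.val / 2)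
    else D.alpha (E(G).ncard - j.val / 2) - D.beta (E(G).ncard - j.val / 2)
  have hwf : WellFounded fun x y : Lex (Fin (2 * E(G).ncard) → ℕ) => x < y := wellFounded_lt
  refine Subrelation.wf (r := InvImage (· < ·) f) ?_ (InvImage.wf f hwf)
  rintro D' D ⟨j, hj, hlt⟩
  simp only [fatness, Pi.toLex_apply] at hj hlt
  have heven : ∀ l < j, l.val % 2 = 0 →
      D'.alpha (E(G).ncard - l.val / 2) = D.alpha (E(G).ncard - l.val / 2) := by
    intro l hl h₀
    have := hj l hl
    rw [if_pos h₀, if_pos h₀] at this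
    exact_mod_cast this
  have hodd : ∀ l ≤ j, l.val % 2 ≠ 0 →
      D'.alpha (E(G).ncard - l.val / 2) = D.alpha (E(G).ncard - l.val / 2) := by
    intro l hl h₀
    have hl' : l.val ≤ j.val := hl
    have h₁ := heven ⟨l.val - 1, by omega⟩
      (show l.val - 1 < j.val by omega) (show (l.val - 1) % 2 = 0 by omega)
    have h₂ : (l.val - 1) / 2 = l.val / 2 := by omega
    simpa only [h₂] using h₁
  refine ⟨j, fun l hl => ?_, ?_⟩
  · have h₁ := hj l hl
    simp only [f, Pi.toLex_apply]
    split_ifs with h₀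
    · exact heven l hl h₀
    · rw [if_neg h₀, if_neg h₀] at h₁
      rw [hodd l hl.le h₀]
      omega
  · simp only [f, Pi.toLex_apply]
    split_ifs with h₀
    · rw [if_pos h₀, if_pos h₀] at hlt
      exact_mod_cast hlt
    · rw [if_neg h₀, if_neg h₀] at hlt
      have h₁ := hodd j le_rfl h₀
      have h₂ := D'.beta_le_alpha (E(G).ncard - j.val / 2)
      omega

/-! ### Minimal certificates -/

lemma exists_isMinimalCertificate (h : ¬ D.IsLeanDecomposition) :
    ∃ (k : ℕ) (a b : Sym2 D.Node) (A B : Set β), D.IsMinimalCertificate k a b A B := by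
  have hex : ∃ p : ℕ × Sym2 D.Node × Sym2 D.Node × Set β × Set β,
      D.IsCertificate p.1 p.2.1 p.2.2.1 p.2.2.2.1 p.2.2.2.2 := by
    simp only [IsLeanDecomposition] at h
    push Not at h
    obtain ⟨k, a, b, ha, hb, A, B, hA, hB, hAk, hBk, hno, hle⟩ := h
    refine ⟨(k, a, b, A, B), Nat.one_le_iff_ne_zero.2 ?_, ha, hb, hA, hB, hAk, hBk, hno, hle⟩
    rintro rfl
    exact hno ⟨fun i => i.elim0, fun i => i.elim0, fun i => i.elim0⟩
  obtain ⟨p, hp, hmin⟩ := WellFounded.has_min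
    (InvImage.wf (fun p : ℕ × Sym2 D.Node × Sym2 D.Node × Set β × Set β =>
      (toLex (p.1, (linkPath D.tree p.2.1 p.2.2.1).ncard) : ℕ ×ₗ ℕ)) wellFounded_lt)
    {p | D.IsCertificate p.1 p.2.1 p.2.2.1 p.2.2.2.1 p.2.2.2.2} hex
  refine ⟨p.1, p.2.1, p.2.2.1, p.2.2.2.1, p.2.2.2.2, hp, fun k' a' b' A' B' h' => ?_⟩
  have h₁ := not_lt.1 (hmin (k', a', b', A', B') h')
  exact Prod.Lex.toLex_le_toLex.1 h₁

/-- If some `e ∈ F` did not leave `W`, then deleting `e` from `F` and one element each from `A` and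
`B` (the edge `e` itself wherever it occurs) would leave a certificate of size `k - 1`, still split
by `W`. -/
lemma IsMinimalCertificate.boundary_eq [G.Loopless] (hE : E(G).Finite) {k : ℕ} {A B F : Set β}
    {W : Set α} (h : D.IsMinimalCertificate k a b A B) (hF : F ⊆ E(G)) (hFk : F.ncard < k)
    (hW : Splits G A B F W) : boundary G W = F := by
  refine hW.boundary_subset.antisymm fun e he => ?_
  by_contra heW
  have hsub : ∀ C : Set β, C.ncard = k → ∃ C' ⊆ C \ {e}, C'.ncard = k - 1 := fun C hC => by
    apply Set.exists_subset_card_eq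
    have := Set.pred_ncard_le_ncard_sdiff_singleton C e
    omega
  obtain ⟨A', hA', hAk⟩ := hsub A h.1.left_card
  obtain ⟨B', hB', hBk⟩ := hsub B h.1.right_card
  have hFe := Set.ncard_sdiff_singleton_add_one he (hE.subset hF)
  have hsplit : Splits G A' B' (F \ {e}) W := by
    refine ⟨fun f hf => ⟨hW.boundary_subset hf, ?_⟩, fun f hf hfF => ?_, fun f hf hfF => ?_⟩
    · rintro rfl
      exact heW hf
    · exact hW.left f (hA' hf).1 fun h => hfF ⟨h, (hA' hf).2⟩
    · exact hW.right f (hB' hf).1 fun h => hfF ⟨h, (hB' hf).2⟩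
  have hcert : D.IsCertificate (k - 1) a b A' B' :=
    { one_le := by omega
      left_mem := h.1.left_mem
      right_mem := h.1.right_mem
      left_subset := (hA'.trans Set.sdiff_subset).trans h.1.left_subset
      right_subset := (hB'.trans Set.sdiff_subset).trans h.1.right_subset
      left_card := hAk
      right_card := hBk
      not_linked := fun hpaths => by
        have := (hsplit.isSeparator (Set.sdiff_subset.trans hF)).le_ncard hE hpaths
        omega
      le_adhesion := fun c hc => (Nat.sub_le k 1).trans (h.1.le_adhesion c hc) }
  have := h.2 _ _ _ _ _ hcert
  omega

lemma IsMinimalCertificate.exists_isReduction [G.Loopless] (hE : E(G).Finite) {k : ℕ}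
    {A B : Set β} (h : D.IsMinimalCertificate k a b A B) :
    ∃ (μ : ℕ) (W : Set α), D.IsReduction k μ a b A B W := by
  have := D.finite_node
  have hc := h.1
  have hA : A ⊆ E(G) := hc.left_subset.trans adhesion_subset
  obtain ⟨F₀, hF₀, hF₀k⟩ := exists_isSeparator_of_not_hasDisjointPaths hE hA hc.not_linked
  obtain ⟨F, hF, hmin⟩ := WellFounded.has_min (InvImage.wf Set.ncard wellFounded_lt)
    {F | IsSeparator G A B F} ⟨F₀, hF₀⟩
  have hmin' : ∀ F', IsSeparator G A B F' → F.ncard ≤ F'.ncard := fun F' hF' =>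
    not_lt.1 (hmin F' hF')
  have hFk : F.ncard < k := (hmin' F₀ hF₀).trans_lt hF₀k
  obtain ⟨W₀, hW₀⟩ := IsSeparator.exists_splits hA hF
  have hbd := h.boundary_eq hE hF.1 hFk hW₀
  have hend : ∀ r, ∀ e ∈ D.adhesion r, ∃ x, G.Inc e x := fun r e he => by
    obtain ⟨x, y, hxy⟩ := Graph.exists_isLink_of_mem_edgeSet (adhesion_subset he)
    exact ⟨x, hxy.inc_left⟩
  -- Here `F = ∂W₀` is needed: an edge of `A` or `B` inside the cut must have an end on each side of
  -- `W₀`.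
  have hconf : IsConfig G A B F.ncard W₀ := by
    refine ⟨fun e he => ?_, fun e he => ?_, by rw [hbd]⟩
    · by_cases heF : e ∈ F
      · rw [← hbd] at heF
        obtain ⟨x, y, hxy, hx, -⟩ := heF
        exact ⟨x, hx, hxy.inc_left⟩
      · obtain ⟨x, hx⟩ := hend a e (hc.left_subset he)
        exact ⟨x, hW₀.left e he heF x hx, hx⟩
    · by_cases heF : e ∈ F
      · rw [← hbd] at heF
        obtain ⟨x, y, hxy, -, hy⟩ := heF
        exact ⟨y, hy, hxy.inc_right⟩
      · obtain ⟨x, hx⟩ := hend b e (hc.right_subset he)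
        exact ⟨x, hW₀.right e he heF x hx, hx⟩
  have hbound : SplitBound G A B F.ncard := fun F' hF' W' hW' => hmin' F' (hW'.isSeparator hF')
  -- The family consists of the bag unions of all sides that miss an end of `a` and an end of `b`;
  -- it is laminar with `a` as the root.
  obtain ⟨W, hW, hunc⟩ := hconf.exists_uncrossed
    (ι := {S : Set D.Node // (∃ c, IsSide D.tree c S) ∧ (∃ t ∈ a, t ∉ S) ∧ ∃ t ∈ b, t ∉ S})
    hE hbound (fun S => D.bagUnion S.1)
    (by
      rintro ⟨S, ⟨c, hS⟩, hSa, hSb⟩ e he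
      exact exists_inc_notMem_bagUnion hc.left_mem hS hSa (hc.left_subset he))
    (by
      rintro ⟨S, ⟨c, hS⟩, hSa, hSb⟩ e he
      exact exists_inc_notMem_bagUnion hc.right_mem hS hSb (hc.right_subset he))
    (by
      rintro ⟨S, ⟨c, hS⟩, hSa, -⟩ ⟨S', ⟨c', hS'⟩, hSa', -⟩
      rcases hS.laminar D.isTree.connected hS' hc.left_mem hSa hSa' with h₁ | h₁ | h₁
      · exact .inl (bagUnion_mono h₁)
      · exact .inr (.inl (bagUnion_mono h₁))
      · exact .inr (.inr (bagUnion_disjoint h₁)))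
  exact ⟨F.ncard, W, hE, hc.left_mem, hc.right_mem, hc.left_subset, hc.right_subset, hc.left_card,
    hc.right_card, hFk, hW, hbound, fun c S hS hSa hSb => hunc ⟨S, ⟨c, hS⟩, hSa, hSb⟩⟩

namespace IsReduction

variable {k μ : ℕ} {A B : Set β} {W : Set α}

lemma isMinSeparator (h : D.IsReduction k μ a b A B W) [G.Loopless] :
    IsMinSeparator G A B (boundary G W) := by
  refine ⟨h.isConfig.splits.isSeparator boundary_subset, fun F hF => ?_⟩
  obtain ⟨W', hW'⟩ := IsSeparator.exists_splits (h.left_subset.trans adhesion_subset) hF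
  exact h.isConfig.card_le.trans (h.splitBound F hF.1 W' hW')

end IsReduction

lemma boundary_eq_edgesBetween (G : Graph α β) (W : Set α) :
    boundary G W = edgesBetween G (V(G) ∩ W) (V(G) \ W) := by
  ext e
  constructor
  · rintro ⟨x, y, hxy, hx, hy⟩
    exact ⟨x, ⟨hxy.left_mem, hx⟩, y, ⟨hxy.right_mem, hy⟩, hxy⟩
  · rintro ⟨x, hx, y, hy, hxy⟩
    exact ⟨x, y, hxy, hx.2, hy.2⟩

lemma subset_edgesBetween_union {A : Set β} {W : Set α} (hA : ∀ e ∈ A, ∃ x ∈ W, G.Inc e x) :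
    A ⊆ edgesBetween G (V(G) ∩ W) (V(G) ∩ W) ∪ boundary G W := by
  intro e he
  by_cases heW : e ∈ boundary G W
  · exact .inr heW
  · obtain ⟨x, hx, y, hxy⟩ := hA e he
    exact .inl ⟨x, ⟨hxy.left_mem, hx⟩, y, ⟨hxy.right_mem,
      mem_of_notMem_boundary heW hxy.inc_left hxy.inc_right hx⟩, hxy⟩

/-- The decomposition with a single bag. -/
def singleBag (G : Graph α β) : TreeCutDecomposition G where
  Node := Unit
  finite_node := inferInstance
  tree := ⊥
  isTree := ⟨⟨fun _ _ => .refl _⟩, SimpleGraph.isAcyclic_bot⟩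
  bag := fun _ => V(G)
  disjoint_bag := fun s t h => absurd (Subsingleton.elim s t) h
  iUnion_bag := Set.iUnion_const _

end TreeCutDecomposition

end TreeCut

/-! ### The main theorem -/

theorem mainTheorem2 {α : Type*} {β : Type*} (G : Graph α β) [G.Loopless]
    (hV : V(G).Finite) (hE : E(G).Finite) (hG : TreeCut.EdgeConnected G 3) :
    -- a decomposition that is not lean can be improved
    (∀ (w : ℕ) (D : TreeCut.TreeCutDecomposition G), D.width = w → ¬ D.IsLeanDecomposition →
      (∃ D' : TreeCut.TreeCutDecomposition G, D'.width ≤ w ∧ D'.fatness < D.fatness) ∧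
      -- and the improvement is a segregation along a minimum cut for a minimal certificate
      (∃ (k : ℕ) (a b : Sym2 D.Node) (A B : Set β), D.IsMinimalCertificate k a b A B) ∧
      (∀ (k : ℕ) (a b : Sym2 D.Node) (A B : Set β), D.IsMinimalCertificate k a b A B →
        ∃ (F : Set β) (V₁ V₂ : Set α),
          TreeCut.IsMinSeparator G A B F ∧
          V₁ ∪ V₂ = V(G) ∧ Disjoint V₁ V₂ ∧
          F = TreeCut.edgesBetween G V₁ V₂ ∧
          A ⊆ TreeCut.edgesBetween G V₁ V₁ ∪ F ∧
          B ⊆ TreeCut.edgesBetween G V₂ V₂ ∪ F ∧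
          ∃ D' : TreeCut.TreeCutDecomposition G, D.IsSegregation a b V₁ V₂ D' ∧
            D'.width ≤ w ∧ D'.fatness < D.fatness)) ∧
    -- fatness is well-founded
    (WellFounded fun D' D : TreeCut.TreeCutDecomposition G => D'.fatness < D.fatness) ∧
    -- there is a lean decomposition of minimum width
    (∃ D : TreeCut.TreeCutDecomposition G, D.IsLeanDecomposition ∧ D.width = TreeCut.treeCutWidth G) := by
  have improve : ∀ (D : TreeCut.TreeCutDecomposition G) (k : ℕ) (a b : Sym2 D.Node)
      (A B : Set β), D.IsMinimalCertificate k a b A B →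
        ∃ (F : Set β) (V₁ V₂ : Set α),
          TreeCut.IsMinSeparator G A B F ∧
          V₁ ∪ V₂ = V(G) ∧ Disjoint V₁ V₂ ∧
          F = TreeCut.edgesBetween G V₁ V₂ ∧
          A ⊆ TreeCut.edgesBetween G V₁ V₁ ∪ F ∧
          B ⊆ TreeCut.edgesBetween G V₂ V₂ ∪ F ∧
          ∃ D' : TreeCut.TreeCutDecomposition G, D.IsSegregation a b V₁ V₂ D' ∧
            D'.width ≤ D.width ∧ D'.fatness < D.fatness := by
    intro D k a b A B hcert
    obtain ⟨μ, W, h⟩ := hcert.exists_isReduction hE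
    refine ⟨TreeCut.boundary G W, V(G) ∩ W, V(G) \ W, h.isMinSeparator,
      Set.inter_union_sdiff _ _, Set.disjoint_sdiff_inter.symm,
      TreeCut.TreeCutDecomposition.boundary_eq_edgesBetween G W,
      TreeCut.TreeCutDecomposition.subset_edgesBetween_union h.isConfig.left, ?_,
      h.result, ⟨SimpleGraph.Iso.refl, fun _ => rfl⟩, h.width_le hV,
      h.fatness_lt hcert.1.le_adhesion⟩
    have := TreeCut.TreeCutDecomposition.subset_edgesBetween_union h.isConfig.symm.left
    rwa [TreeCut.boundary_compl, ← Set.sdiff_eq] at this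
  have smaller : ∀ D : TreeCut.TreeCutDecomposition G, ¬ D.IsLeanDecomposition →
      ∃ D' : TreeCut.TreeCutDecomposition G, D'.width ≤ D.width ∧ D'.fatness < D.fatness := by
    intro D hD
    obtain ⟨k, a, b, A, B, hcert⟩ := TreeCut.TreeCutDecomposition.exists_isMinimalCertificate hD
    obtain ⟨-, -, -, -, -, -, -, -, -, D', -, hw, hf⟩ := improve D k a b A B hcert
    exact ⟨D', hw, hf⟩
  have hwf := TreeCut.TreeCutDecomposition.wellFounded_fatness G
  refine ⟨?_, hwf, ?_⟩
  · rintro w D rfl hD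
    exact ⟨smaller D hD, TreeCut.TreeCutDecomposition.exists_isMinimalCertificate hD, improve D⟩
  -- Among the decompositions of minimum width, one of minimal fatness is taken; an improvement
  -- would keep the width minimum and lower the fatness.
  · obtain ⟨D, hD, hmin⟩ := hwf.has_min
      {D : TreeCut.TreeCutDecomposition G | D.width = TreeCut.treeCutWidth G}
      (Nat.sInf_mem (s := {w | ∃ D : TreeCut.TreeCutDecomposition G, D.width = w})
        ⟨_, TreeCut.TreeCutDecomposition.singleBag G, rfl⟩)
    refine ⟨D, ?_, hD⟩
    by_contra hlean
    obtain ⟨D', hw, hf⟩ := smaller D hlean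
    refine hmin D' (le_antisymm (hw.trans_eq hD) ?_) hf
    exact Nat.sInf_le ⟨D', rfl⟩
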